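/- Let $d\ge 1$ and let $A$ be an integer $d\times d$ matrix that is a dilation matrix (all eigenvalues are greater than $1$ in absolute value) and isotropic (diagonalizable over $\mathbb C$ with all eigenvalues equal in absolute value). Put $q:=|\det A|$ and $A^{-T}:=(A^T)^{-1}$, and let $Q$ be any real symmetric positive definite matrix with $$A^{-T}=q^{-1/d}\,Q^{-1}UQ\quad\text{for some orthogonal matrix }U .$$ With $Q^2=(q_{ij})$ define, for $\xi\in\mathbb R^d$, $$G(\xi):=4\sum_{i}q_{ii}\sin^2\frac{\xi_i}{2}+2\sum_{i<j}q_{ij}\sin\xi_i\sin\xi_j,\qquad m_0(\xi):=\frac{\prod_{s\in S\setminus\{0\}}G(\xi+2\pi s)}{\prod_{s\in S\setminus\{0\}}G(2\pi s)},$$ where $S:=\{s\in[0,1)^d: A^Ts\in\mathbb Z^d\}$, and $$\mu(\xi):=\frac{q^{2/d}\,m_0(A^{-T}\xi)\,G(A^{-T}\xi)}{G(\xi)}$$ (extended continuously by the value $1$ at the zeros of $G$, i.e. at the points of $2\pi\mathbb Z^d$), $\mathcal B:=\sup_{\xi\in\mathbb R^d}\mu(\xi)$. For $m\ge 1$ let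 the elliptic scaling function $\phi^m$ be the tempered distribution on $\mathbb R^d$ whose Fourier transform (in the convention $\hat f(\xi)=\int f(x)e^{-i\xi\cdot x}\,dx$) is the function $$\widehat{\phi^m}(\xi)=\bigl(\hat\phi(\xi)\bigr)^m,\qquad \hat\phi(\xi):=\prod_{j=1}^\infty m_0\bigl((A^{-T})^j\xi\bigr).$$ If $$\mathcal B<|\det A|^{\frac2d-\frac1{2m}},$$ then there is exactly one such distribution $\phi^m$; it belongs to $L^2(\mathbb R^d)$; its integer shifts form a Riesz basis of their closed linear span in $L^2(\mathbb R^d)$, i.e. there are constants $0<a\le b<\infty$ such that $$a\sum_{k}|c_k|^2\le\Bigl\|\sum_{k}c_k\,\phi^m(\cdot-k)\Bigr\|_{L^2(\mathbb R^d)}^2\le b\sum_{k}|c_k|^2$$ for all finitely supported complex sequences $(c_k)_{k\in\mathbb Z^d}$; and the series $\sum_{k\in\mathbb Z^d}|\widehat{\phi^m}(\xi+2\pi k)|^2$ converges for every $\xi\in\mathbb R^d$. -/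

import Mathlib

open MeasureTheory
open scoped SchwartzMap FourierTransform Matrix

noncomputable section

namespace EllipticScaling

/-- An integer matrix, read as a real matrix. -/
abbrev realMat {d : ℕ} (A : Matrix (Fin d) (Fin d) ℤ) : Matrix (Fin d) (Fin d) ℝ :=
  A.map (fun n : ℤ => (n : ℝ))

/-- An integer matrix, read as a complex matrix. -/
abbrev complexMat {d : ℕ} (A : Matrix (Fin d) (Fin d) ℤ) : Matrix (Fin d) (Fin d) ℂ :=
  A.map (fun n : ℤ => (n : ℂ))

/-- Dilation matrix: an integer matrix all of whose (complex) eigenvalues are greater than `1`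
in absolute value. -/
def IsDilation {d : ℕ} (A : Matrix (Fin d) (Fin d) ℤ) : Prop :=
  ∀ z ∈ spectrum ℂ (complexMat A), 1 < ‖z‖

/-- Isotropic matrix: diagonalizable over `ℂ`, with all eigenvalues equal in absolute value. -/
def IsIsotropic {d : ℕ} (A : Matrix (Fin d) (Fin d) ℤ) : Prop :=
  (∃ (S : Matrix (Fin d) (Fin d) ℂ) (D : Fin d → ℂ),
      IsUnit S ∧ complexMat A * S = S * Matrix.diagonal D) ∧
    ∀ z ∈ spectrum ℂ (complexMat A), ∀ w ∈ spectrum ℂ (complexMat A), ‖z‖ = ‖w‖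

/-- `q = |det A|`. -/
def absDet {d : ℕ} (A : Matrix (Fin d) (Fin d) ℤ) : ℝ := |(A.det : ℝ)|

/-- The matrix `A^{-T}`. -/
def invTranspose {d : ℕ} (A : Matrix (Fin d) (Fin d) ℤ) : Matrix (Fin d) (Fin d) ℝ :=
  ((realMat A)⁻¹)ᵀ

/-- `Q` is a similarity transformation matrix of `A`: it is symmetric positive definite, and
`A^{-T} = q^{-1/d} Q⁻¹ U Q` for some orthogonal matrix `U`. -/
def IsSimilarityMatrix {d : ℕ} (A : Matrix (Fin d) (Fin d) ℤ) (Q : Matrix (Fin d) (Fin d) ℝ) :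
    Prop :=
  Q.PosDef ∧ ∃ U ∈ Matrix.orthogonalGroup (Fin d) ℝ,
    invTranspose A = (1 / absDet A ^ (1 / (d : ℝ))) • (Q⁻¹ * U * Q)

/-- The trigonometric polynomial
`G(ξ) = 4 ∑ᵢ q_{ii} sin² (ξᵢ / 2) + 2 ∑_{i < j} q_{ij} sin ξᵢ sin ξⱼ`, with `Q² = (q_{ij})`. -/
def G {d : ℕ} (Q : Matrix (Fin d) (Fin d) ℝ) (ξ : Fin d → ℝ) : ℝ :=
  4 * ∑ i, (Q ^ 2) i i * Real.sin (ξ i / 2) ^ 2 +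
    2 * ∑ i, ∑ j ∈ Finset.Ioi i, (Q ^ 2) i j * Real.sin (ξ i) * Real.sin (ξ j)

/-- The set `S(B)` of the points `s ∈ [0,1)^d` such that `B s` is an integer vector. For a
nonsingular `B` it is finite, with `|det B|` elements. -/
def digitPoints {d : ℕ} (B : Matrix (Fin d) (Fin d) ℤ) : Set (Fin d → ℝ) :=
  {s | (∀ i, s i ∈ Set.Ico (0 : ℝ) 1) ∧ ∃ n : Fin d → ℤ, realMat B *ᵥ s = fun i => (n i : ℝ)}

/-- The mask `m₀`. -/
def mask {d : ℕ} (A : Matrix (Fin d) (Fin d) ℤ) (Q : Matrix (Fin d) (Fin d) ℝ)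
    (ξ : Fin d → ℝ) : ℝ :=
  (∏ᶠ s ∈ digitPoints Aᵀ \ {0}, G Q (ξ + (2 * Real.pi) • s)) /
    (∏ᶠ s ∈ digitPoints Aᵀ \ {0}, G Q ((2 * Real.pi) • s))

open Classical in
/-- The function `μ(ξ) = q^{2/d} m₀(A^{-T} ξ) G(A^{-T} ξ) / G(ξ)`. The quotient has removable
singularities at the zeros of `G` (the points of `2πℤ^d`), where its continuous extension takes
the value `1`. -/
def mu {d : ℕ} (A : Matrix (Fin d) (Fin d) ℤ) (Q : Matrix (Fin d) (Fin d) ℝ)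
    (ξ : Fin d → ℝ) : ℝ :=
  if G Q ξ = 0 then 1
  else absDet A ^ (2 / (d : ℝ)) * mask A Q (invTranspose A *ᵥ ξ) * G Q (invTranspose A *ᵥ ξ) /
    G Q ξ

/-- The constant `𝓑 = sup_ξ μ(ξ)` (the function `μ` is bounded). -/
def supMu {d : ℕ} (A : Matrix (Fin d) (Fin d) ℤ) (Q : Matrix (Fin d) (Fin d) ℝ) : ℝ :=
  ⨆ ξ : Fin d → ℝ, mu A Q ξ

/-- The Fourier transform `∏_{j ≥ 1} m₀((A^{-T})^j ξ)` of the elliptic scaling function `φ` of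
the first order, in the convention `∫ φ(x) e^{-i ξ·x} dx`. -/
def phiHat {d : ℕ} (A : Matrix (Fin d) (Fin d) ℤ) (Q : Matrix (Fin d) (Fin d) ℝ)
    (ξ : Fin d → ℝ) : ℝ :=
  ∏' j : ℕ, mask A Q ((invTranspose A ^ (j + 1)) *ᵥ ξ)

/-- The tempered distribution `T` is the elliptic scaling function `φ^m` of order `m`: its
Fourier transform, in the convention `∫ T(x) e^{-i ξ·x} dx`, is the function `(φ̂)^m`. As Mathlib's
`𝓕` has the kernel `e^{-2π i ν·x}`, this says that `𝓕 T` is the function `ν ↦ φ̂(2πν)^m`. -/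
def IsEllipticScalingFunction {d : ℕ} (A : Matrix (Fin d) (Fin d) ℤ)
    (Q : Matrix (Fin d) (Fin d) ℝ) (m : ℕ) (T : 𝓢'(EuclideanSpace ℝ (Fin d), ℂ)) : Prop :=
  ∀ f : 𝓢(EuclideanSpace ℝ (Fin d), ℂ),
    Integrable (fun ν => f ν * ((phiHat A Q ((2 * Real.pi) • ν.ofLp) ^ m : ℝ) : ℂ)) ∧
      (𝓕 T) f = ∫ ν, f ν * ((phiHat A Q ((2 * Real.pi) • ν.ofLp) ^ m : ℝ) : ℂ)

/-- The shift `φ(· - k)` of an `L²` function by an integer vector `k`. -/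
def integerShift {d : ℕ} (k : Fin d → ℤ)
    (φ : Lp ℂ 2 (volume : Measure (EuclideanSpace ℝ (Fin d)))) :
    Lp ℂ 2 (volume : Measure (EuclideanSpace ℝ (Fin d))) :=
  Lp.compMeasurePreserving (fun x => x - WithLp.toLp 2 (fun i => (k i : ℝ)))
    (measurePreserving_sub_right volume _) φ

/-- The family `f` forms a Riesz basis (of the closure of its linear span): there are Riesz bounds
`0 < a ≤ b` with `a ∑ |cᵢ|² ≤ ‖∑ cᵢ fᵢ‖² ≤ b ∑ |cᵢ|²` for all finitely supported `c`. -/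
def FormsRieszBasis {ι H : Type*} [NormedAddCommGroup H] [InnerProductSpace ℂ H]
    (f : ι → H) : Prop :=
  ∃ a b : ℝ, 0 < a ∧ a ≤ b ∧ ∀ c : ι →₀ ℂ,
    a * (∑ i ∈ c.support, ‖c i‖ ^ 2) ≤ ‖∑ i ∈ c.support, c i • f i‖ ^ 2 ∧
      ‖∑ i ∈ c.support, c i • f i‖ ^ 2 ≤ b * (∑ i ∈ c.support, ‖c i‖ ^ 2)

end EllipticScaling

end

/-! Put ρ = q^{1/d} (`dilationFactor`) and κ = 𝓑 ρ^{-2}. Two facts drive the proof. The matrix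
A^{-T} shrinks the norm |Qv| by exactly the factor ρ (`normQSq_invTranspose_mulVec`). The polynomial
G lies between positive multiples of the discrete Laplacian's symbol, so it vanishes only on 2πℤ^d,
to second order.

Decay: the definition of 𝓑 gives m₀(A^{-T}ξ) G(A^{-T}ξ) ≤ κ G(ξ), which telescopes along the orbit
of ξ (`prod_mask_mul_G_le`). Stopping at the n for which the n-th iterate lies in a fixed annulus
around 0, where G is bounded below, gives φ̂(ξ) ≤ C κ^n with ρ^n comparable to 1 + |ξ|. The
hypothesis on 𝓑 says κ^{2m} < q^{-1} = ρ^{-d}, hence |φ̂(ξ)^m|² ≤ C (1 + |ξ|)^{-τ} for some τ > d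
(`exists_phiHat_decay`).

Consequences: the sum over 2πℤ^d converges, with a majorant uniform on bounded sets. Below, φ̂ has a
positive minimum on [-π,π]^d, since φ̂(0) = 1 and φ̂ can vanish only on 2πℤ^d. Shifts become
characters under the Fourier transform, so Plancherel and Parseval on the unit cube turn these two
bounds into the Riesz bounds (`exists_scalingSymbol_bounds`). The upper bound for a single shift
puts φ̂^m in L², and invertibility of the Fourier transform on tempered distributions gives
existence and uniqueness. -/

namespace EllipticScaling

variable {d : ℕ} {A : Matrix (Fin d) (Fin d) ℤ} {Q : Matrix (Fin d) (Fin d) ℝ}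

/-! ### Quadratic forms and the trigonometric polynomial `G` -/

lemma exists_mulVec_dotProduct_le (P : Matrix (Fin d) (Fin d) ℝ) :
    ∃ C : ℝ, 0 < C ∧ ∀ v, (P *ᵥ v) ⬝ᵥ (P *ᵥ v) ≤ C * (v ⬝ᵥ v) := by
  -- Cauchy–Schwarz row by row; the `+ 1` only keeps the constant positive when `P = 0`.
  refine ⟨∑ i, ∑ j, P i j ^ 2 + 1, by positivity, fun v => ?_⟩
  have h0 : 0 ≤ v ⬝ᵥ v := by
    simp only [dotProduct]; exact Finset.sum_nonneg fun i _ => mul_self_nonneg _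
  have : (P *ᵥ v) ⬝ᵥ (P *ᵥ v) ≤ (∑ i, ∑ j, P i j ^ 2) * (v ⬝ᵥ v) := by
    rw [Finset.sum_mul]
    refine Finset.sum_le_sum fun i _ => ?_
    simpa only [dotProduct, Matrix.mulVec, ← pow_two] using
      Finset.sum_mul_sq_le_sq_mul_sq Finset.univ (P i) v
  nlinarith

/-- The squared norm `|Q v|²`. -/
noncomputable def normQSq (Q : Matrix (Fin d) (Fin d) ℝ) (v : Fin d → ℝ) : ℝ :=
  (Q *ᵥ v) ⬝ᵥ (Q *ᵥ v)

lemma exists_normQSq_le (Q : Matrix (Fin d) (Fin d) ℝ) :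
    ∃ C : ℝ, 0 < C ∧ ∀ v, normQSq Q v ≤ C * (v ⬝ᵥ v) :=
  exists_mulVec_dotProduct_le Q

lemma exists_le_normQSq (hQ : IsUnit Q.det) :
    ∃ c : ℝ, 0 < c ∧ ∀ v, c * (v ⬝ᵥ v) ≤ normQSq Q v := by
  obtain ⟨C, hC, h⟩ := exists_mulVec_dotProduct_le Q⁻¹
  refine ⟨C⁻¹, by positivity, fun v => ?_⟩
  have := h (Q *ᵥ v)
  rw [Matrix.mulVec_mulVec, Matrix.nonsing_inv_mul _ hQ, Matrix.one_mulVec] at this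
  rw [inv_mul_le_iff₀ hC]
  exact this

lemma normQSq_eq_sum (hQ : Qᵀ = Q) (v : Fin d → ℝ) :
    normQSq Q v = ∑ i, ∑ j, (Q ^ 2) i j * v i * v j := by
  have : normQSq Q v = v ⬝ᵥ ((Q ^ 2) *ᵥ v) := by
    rw [normQSq, pow_two, ← Matrix.mulVec_mulVec, Matrix.dotProduct_mulVec v,
      ← Matrix.mulVec_transpose, hQ]
  rw [this]
  simp only [dotProduct, Matrix.mulVec, Finset.mul_sum]
  exact Finset.sum_congr rfl fun i _ => Finset.sum_congr rfl fun j _ => by ring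

lemma normQSq_single (hQ : Qᵀ = Q) (i : Fin d) : normQSq Q (Pi.single i 1) = (Q ^ 2) i i := by
  rw [normQSq_eq_sum hQ]
  simp [Pi.single_apply]

lemma sq_symm (hQ : Qᵀ = Q) (i j : Fin d) : (Q ^ 2) i j = (Q ^ 2) j i := by
  have : (Q ^ 2)ᵀ = Q ^ 2 := by rw [Matrix.transpose_pow, hQ]
  conv_lhs => rw [← this]
  rfl

lemma four_mul_sin_sq (x : ℝ) :
    4 * Real.sin (x / 2) ^ 2 = 4 * Real.sin (x / 2) ^ 4 + Real.sin x ^ 2 := by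
  have h : Real.sin x = 2 * Real.sin (x / 2) * Real.cos (x / 2) := by
    rw [← Real.sin_two_mul]; congr 1; ring
  have h1 := Real.sin_sq_add_cos_sq (x / 2)
  rw [h]
  linear_combination (-4 * Real.sin (x / 2) ^ 2) * h1

/-- Splitting each diagonal term by 4 sin²(x/2) = 4 sin⁴(x/2) + sin² x supplies the missing diagonal
of the quadratic form in (sin ξᵢ). Both remaining summands are visibly nonnegative. -/
lemma G_eq (hQ : Qᵀ = Q) (ξ : Fin d → ℝ) :
    G Q ξ = 4 * ∑ i, (Q ^ 2) i i * Real.sin (ξ i / 2) ^ 4 +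
      normQSq Q (fun i => Real.sin (ξ i)) := by
  rw [normQSq_eq_sum hQ, G]
  have h1 : ∑ i, ∑ j, (Q ^ 2) i j * Real.sin (ξ i) * Real.sin (ξ j) =
      ∑ i, (Q ^ 2) i i * Real.sin (ξ i) ^ 2 +
        2 * ∑ i, ∑ j ∈ Finset.Ioi i, (Q ^ 2) i j * Real.sin (ξ i) * Real.sin (ξ j) := by
    have h2 : ∀ i, ∑ j, (Q ^ 2) i j * Real.sin (ξ i) * Real.sin (ξ j) =
        (Q ^ 2) i i * Real.sin (ξ i) ^ 2 +
        ∑ j ∈ {i}ᶜ, (Q ^ 2) j i * Real.sin (ξ j) * Real.sin (ξ i) := by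
      intro i
      rw [← Finset.sum_compl_add_sum {i}, Finset.sum_singleton, add_comm]
      congr 1
      · ring
      · exact Finset.sum_congr rfl fun j _ => by rw [sq_symm hQ]; ring
    rw [Finset.sum_congr rfl fun i _ => h2 i, Finset.sum_add_distrib,
      ← Finset.sum_sum_Ioi_add_eq_sum_sum_off_diag
        (fun j i => (Q ^ 2) j i * Real.sin (ξ j) * Real.sin (ξ i)), Finset.mul_sum]
    congr 1
    refine Finset.sum_congr rfl fun i _ => ?_
    rw [Finset.mul_sum]
    exact Finset.sum_congr rfl fun j _ => by rw [sq_symm hQ j i]; ring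
  rw [h1, ← add_assoc]
  congr 1
  rw [Finset.mul_sum, Finset.mul_sum, ← Finset.sum_add_distrib]
  refine Finset.sum_congr rfl fun i _ => ?_
  linear_combination (Q ^ 2) i i * four_mul_sin_sq (ξ i)

/-- The symbol `4 ∑ᵢ sin² (ξᵢ / 2)` of the discrete Laplacian. -/
noncomputable def laplaceSymbol (ξ : Fin d → ℝ) : ℝ := ∑ i, 4 * Real.sin (ξ i / 2) ^ 2

lemma laplaceSymbol_eq (ξ : Fin d → ℝ) : laplaceSymbol ξ = 4 * ∑ i, Real.sin (ξ i / 2) ^ 4 +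
    (fun i => Real.sin (ξ i)) ⬝ᵥ (fun i => Real.sin (ξ i)) := by
  simp only [laplaceSymbol, dotProduct, Finset.mul_sum, ← Finset.sum_add_distrib]
  exact Finset.sum_congr rfl fun i _ => by rw [four_mul_sin_sq, pow_two (Real.sin (ξ i))]

/-- `laplaceSymbol` is G for Q = 1, so the decompositions compare term by term. One constant serves
for both parts because q_{ii} = |Q eᵢ|² obeys the same bound as |Qv|². -/
lemma exists_laplaceSymbol_le_G (hQ : Qᵀ = Q) (hdet : IsUnit Q.det) :
    ∃ c : ℝ, 0 < c ∧ ∀ ξ, c * laplaceSymbol ξ ≤ G Q ξ := by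
  obtain ⟨c, hc, h⟩ := exists_le_normQSq hdet
  refine ⟨c, hc, fun ξ => ?_⟩
  rw [laplaceSymbol_eq, G_eq hQ, mul_add]
  refine add_le_add ?_ (h _)
  rw [mul_left_comm, Finset.mul_sum (a := c)]
  refine mul_le_mul_of_nonneg_left (Finset.sum_le_sum fun i _ => ?_) (by norm_num)
  refine mul_le_mul_of_nonneg_right ?_ (by positivity)
  simpa [normQSq_single hQ] using h (Pi.single i 1)

lemma exists_G_le_laplaceSymbol (hQ : Qᵀ = Q) :
    ∃ C : ℝ, 0 < C ∧ ∀ ξ, G Q ξ ≤ C * laplaceSymbol ξ := by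
  obtain ⟨c, hc, h⟩ := exists_normQSq_le Q
  refine ⟨c, hc, fun ξ => ?_⟩
  rw [laplaceSymbol_eq, G_eq hQ, mul_add]
  refine add_le_add ?_ (h _)
  rw [mul_left_comm c, Finset.mul_sum (a := c)]
  refine mul_le_mul_of_nonneg_left (Finset.sum_le_sum fun i _ => ?_) (by norm_num)
  refine mul_le_mul_of_nonneg_right ?_ (by positivity)
  simpa [normQSq_single hQ] using h (Pi.single i 1)

lemma laplaceSymbol_nonneg (ξ : Fin d → ℝ) : 0 ≤ laplaceSymbol ξ :=
  Finset.sum_nonneg fun i _ => by positivity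

lemma laplaceSymbol_le_dotProduct (ξ : Fin d → ℝ) : laplaceSymbol ξ ≤ ξ ⬝ᵥ ξ := by
  refine Finset.sum_le_sum fun i _ => ?_
  have h : Real.sin (ξ i / 2) ^ 2 ≤ (ξ i / 2) ^ 2 := Real.sin_sq_le_sq
  nlinarith

lemma laplaceSymbol_le (ξ : Fin d → ℝ) : laplaceSymbol ξ ≤ 4 * d := by
  calc laplaceSymbol ξ ≤ ∑ i : Fin d, (4 : ℝ) :=
        Finset.sum_le_sum fun i _ => by have := Real.sin_sq_le_one (ξ i / 2); linarith
    _ = 4 * d := by simp [mul_comm]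

/-- Jordan's inequality in each coordinate: |sin t| ≥ 2|t|/π for |t| ≤ π/2. -/
lemma dotProduct_le_laplaceSymbol {ξ : Fin d → ℝ} (hξ : ‖ξ‖ ≤ Real.pi) :
    4 / Real.pi ^ 2 * (ξ ⬝ᵥ ξ) ≤ laplaceSymbol ξ := by
  rw [dotProduct, Finset.mul_sum]
  refine Finset.sum_le_sum fun i _ => ?_
  have h1 : |ξ i| ≤ Real.pi := (norm_le_pi_norm ξ i).trans hξ
  have h2 : 2 / Real.pi * |ξ i / 2| ≤ |Real.sin (ξ i / 2)| :=
    Real.mul_abs_le_abs_sin (by rw [abs_div, abs_two]; linarith)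
  have h3 := pow_le_pow_left₀ (by positivity) h2 2
  rw [mul_pow, sq_abs, sq_abs, div_pow, div_pow] at h3
  have h4 : 4 / Real.pi ^ 2 * (ξ i * ξ i) = 4 * (2 ^ 2 / Real.pi ^ 2 * (ξ i ^ 2 / 2 ^ 2)) := by
    ring
  rw [h4]
  linarith

lemma norm_sq_le_dotProduct (v : Fin d → ℝ) : ‖v‖ ^ 2 ≤ v ⬝ᵥ v := by
  have h0 : 0 ≤ v ⬝ᵥ v := Finset.sum_nonneg fun i _ => mul_self_nonneg _
  rw [← Real.le_sqrt (norm_nonneg _) h0, pi_norm_le_iff_of_nonneg (Real.sqrt_nonneg _)]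
  intro i
  apply Real.le_sqrt_of_sq_le
  rw [Real.norm_eq_abs, sq_abs, pow_two]
  exact Finset.single_le_sum (f := fun i => v i * v i) (fun j _ => mul_self_nonneg _)
    (Finset.mem_univ i)

lemma dotProduct_le_norm_sq (v : Fin d → ℝ) : v ⬝ᵥ v ≤ d * ‖v‖ ^ 2 := by
  calc v ⬝ᵥ v ≤ ∑ i : Fin d, ‖v‖ ^ 2 := Finset.sum_le_sum fun i _ => by
        have := norm_le_pi_norm v i
        rw [Real.norm_eq_abs] at this
        rw [← abs_mul_abs_self, ← pow_two]
        exact pow_le_pow_left₀ (abs_nonneg _) this 2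
    _ = d * ‖v‖ ^ 2 := by simp

/-- The point `2π k` for an integer vector `k`. -/
noncomputable def latticePoint (k : Fin d → ℤ) : Fin d → ℝ := (2 * Real.pi) • (fun i => (k i : ℝ))

lemma sin_add_latticePoint (ξ : Fin d → ℝ) (k : Fin d → ℤ) (i : Fin d) :
    Real.sin ((ξ + latticePoint k) i) = Real.sin (ξ i) := by
  have : (ξ + latticePoint k) i = ξ i + k i * (2 * Real.pi) := by
    simp [latticePoint]; ring
  rw [this, Real.sin_add_int_mul_two_pi]

lemma sin_half_sq_add_latticePoint (ξ : Fin d → ℝ) (k : Fin d → ℤ) (i : Fin d) :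
    Real.sin ((ξ + latticePoint k) i / 2) ^ 2 = Real.sin (ξ i / 2) ^ 2 := by
  have : (ξ + latticePoint k) i / 2 = ξ i / 2 + k i * Real.pi := by
    simp [latticePoint]; ring
  rw [this, Real.sin_add_int_mul_pi, mul_pow]
  rcases Int.even_or_odd (k i) with h | h <;> simp [h.neg_one_zpow]

lemma G_add_latticePoint (ξ : Fin d → ℝ) (k : Fin d → ℤ) :
    G Q (ξ + latticePoint k) = G Q ξ := by
  simp only [G, sin_half_sq_add_latticePoint, sin_add_latticePoint]

lemma exists_eq_latticePoint_of_laplaceSymbol_eq_zero {ξ : Fin d → ℝ}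
    (h : laplaceSymbol ξ = 0) : ∃ k, ξ = latticePoint k := by
  have h1 : ∀ i, ∃ n : ℤ, (n : ℝ) * Real.pi = ξ i / 2 := by
    intro i
    have := (Finset.sum_eq_zero_iff_of_nonneg (fun i _ => by positivity)).1 h i (Finset.mem_univ i)
    rw [← Real.sin_eq_zero_iff]
    simpa using this
  choose k hk using h1
  refine ⟨k, funext fun i => ?_⟩
  have := hk i
  simp only [latticePoint, Pi.smul_apply, smul_eq_mul]
  linarith

lemma exists_eq_add_latticePoint (ξ : Fin d → ℝ) :
    ∃ ζ k, ξ = ζ + latticePoint k ∧ ‖ζ‖ ≤ Real.pi := by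
  have hpi := Real.pi_pos
  refine ⟨fun i => ξ i - 2 * Real.pi * round (ξ i / (2 * Real.pi)),
    fun i => round (ξ i / (2 * Real.pi)), ?_, ?_⟩
  · ext i; simp [latticePoint]
  · rw [pi_norm_le_iff_of_nonneg hpi.le]
    intro i
    have h := abs_sub_round (ξ i / (2 * Real.pi))
    have h2 : ξ i - 2 * Real.pi * round (ξ i / (2 * Real.pi)) =
        2 * Real.pi * (ξ i / (2 * Real.pi) - round (ξ i / (2 * Real.pi))) := by
      field_simp
    rw [h2, Real.norm_eq_abs, abs_mul, abs_of_pos (by positivity : (0:ℝ) < 2 * Real.pi)]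
    nlinarith

lemma G_nonneg (hQ : Qᵀ = Q) (hdet : IsUnit Q.det) (ξ : Fin d → ℝ) : 0 ≤ G Q ξ := by
  obtain ⟨c, hc, h⟩ := exists_laplaceSymbol_le_G hQ hdet
  exact (mul_nonneg hc.le (laplaceSymbol_nonneg ξ)).trans (h ξ)

lemma exists_eq_latticePoint_of_G_eq_zero (hQ : Qᵀ = Q) (hdet : IsUnit Q.det) {ξ : Fin d → ℝ}
    (h0 : G Q ξ = 0) : ∃ k, ξ = latticePoint k := by
  obtain ⟨c, hc, h⟩ := exists_laplaceSymbol_le_G hQ hdet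
  refine exists_eq_latticePoint_of_laplaceSymbol_eq_zero (le_antisymm ?_ (laplaceSymbol_nonneg ξ))
  have := h ξ
  rw [h0] at this
  by_contra hcon
  push Not at hcon
  nlinarith [mul_pos hc hcon]

lemma G_zero : G Q 0 = 0 := by simp [G]

@[fun_prop]
lemma differentiable_G : Differentiable ℝ (G Q) := by
  unfold G
  fun_prop

/-! ### The dilation -/

/-- The determinant is the product of the d ≥ 1 complex eigenvalues, each of modulus above 1. -/
lemma one_lt_absDet (hd : 1 ≤ d) (hA : IsDilation A) : 1 < absDet A := by
  have h1 : ((A.det : ℤ) : ℂ) = (complexMat A).det := by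
    simpa using RingHom.map_det (Int.castRingHom ℂ) A
  have h2 : (absDet A : ℝ) = ‖(complexMat A).det‖ := by
    rw [← h1, absDet, ← Complex.ofReal_intCast, Complex.norm_real, Real.norm_eq_abs]
  rw [h2, Matrix.det_eq_prod_roots_charpoly]
  have hroots : ∀ z ∈ (complexMat A).charpoly.roots, 1 < ‖z‖ := fun z hz =>
    hA z (Matrix.mem_spectrum_of_isRoot_charpoly (Polynomial.isRoot_of_mem_roots hz))
  have hcard : Multiset.card (complexMat A).charpoly.roots = d := by
    rw [IsAlgClosed.card_roots_eq_natDegree, Matrix.charpoly_natDegree_eq_dim, Fintype.card_fin]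
  generalize (complexMat A).charpoly.roots = s at hroots hcard
  have key : ∀ s : Multiset ℂ, (∀ z ∈ s, 1 < ‖z‖) → 1 ≤ ‖s.prod‖ := by
    intro s
    induction s using Multiset.induction with
    | empty => simp
    | cons a s ih =>
      intro h
      rw [Multiset.prod_cons, norm_mul]
      exact one_le_mul_of_one_le_of_one_le (h a (by simp)).le
        (ih fun z hz => h z (Multiset.mem_cons_of_mem hz))
  obtain ⟨a, ha⟩ : ∃ a, a ∈ s := Multiset.card_pos_iff_exists_mem.1 (by omega)
  obtain ⟨t, rfl⟩ := Multiset.exists_cons_of_mem ha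
  rw [Multiset.prod_cons, norm_mul]
  exact one_lt_mul_of_lt_of_le (hroots a (by simp))
    (key t fun z hz => hroots z (Multiset.mem_cons_of_mem hz))

/-- The common modulus `q^{1/d}` of the eigenvalues of `A`. -/
noncomputable def dilationFactor (A : Matrix (Fin d) (Fin d) ℤ) : ℝ := absDet A ^ (1 / (d : ℝ))

lemma one_lt_dilationFactor (hd : 1 ≤ d) (h : 1 < absDet A) : 1 < dilationFactor A :=
  Real.one_lt_rpow h (by positivity)

lemma dilationFactor_sq (h : 1 < absDet A) : dilationFactor A ^ 2 = absDet A ^ (2 / (d : ℝ)) := by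
  rw [dilationFactor, ← Real.rpow_natCast, ← Real.rpow_mul (by linarith)]
  congr 1; push_cast; ring

lemma IsSimilarityMatrix.transpose_eq (hQ : IsSimilarityMatrix A Q) : Qᵀ = Q := by
  simpa [Matrix.IsHermitian] using hQ.1.isHermitian

lemma IsSimilarityMatrix.isUnit_det (hQ : IsSimilarityMatrix A Q) : IsUnit Q.det :=
  isUnit_iff_ne_zero.2 hQ.1.det_pos.ne'

lemma normQSq_invTranspose_mulVec (hQ : IsSimilarityMatrix A Q) (v : Fin d → ℝ) :
    normQSq Q (invTranspose A *ᵥ v) = (dilationFactor A)⁻¹ ^ 2 * normQSq Q v := by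
  obtain ⟨U, hU, h⟩ := hQ.2
  have hU' : Uᵀ * U = 1 := (Matrix.mem_orthogonalGroup_iff' _ _).1 hU
  have h1 : Q *ᵥ (invTranspose A *ᵥ v) = (dilationFactor A)⁻¹ • (U *ᵥ (Q *ᵥ v)) := by
    rw [h, Matrix.smul_mulVec, Matrix.mulVec_smul, Matrix.mulVec_mulVec, ← Matrix.mul_assoc,
      ← Matrix.mul_assoc, Matrix.mul_nonsing_inv _ hQ.isUnit_det, Matrix.one_mul,
      Matrix.mulVec_mulVec, dilationFactor, one_div]
  rw [normQSq, h1, smul_dotProduct, dotProduct_smul, Matrix.dotProduct_mulVec,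
    ← Matrix.mulVec_transpose, Matrix.mulVec_mulVec, hU', Matrix.one_mulVec, normQSq]
  simp only [smul_eq_mul]
  ring

lemma normQSq_invTranspose_pow_mulVec (hQ : IsSimilarityMatrix A Q) (n : ℕ) (v : Fin d → ℝ) :
    normQSq Q (invTranspose A ^ n *ᵥ v) = (dilationFactor A)⁻¹ ^ (2 * n) * normQSq Q v := by
  induction n with
  | zero => simp
  | succ n ih =>
    rw [pow_succ', ← Matrix.mulVec_mulVec, normQSq_invTranspose_mulVec hQ, ih]
    ring

lemma exists_norm_invTranspose_pow_mulVec_le (hQ : IsSimilarityMatrix A Q) (h : 1 < absDet A) :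
    ∃ C : ℝ, 0 < C ∧ ∀ (n : ℕ) (v : Fin d → ℝ),
      ‖invTranspose A ^ n *ᵥ v‖ ≤ C * (dilationFactor A)⁻¹ ^ n * ‖v‖ := by
  obtain ⟨c, hc, h1⟩ := exists_le_normQSq hQ.isUnit_det
  obtain ⟨C, hC, h2⟩ := exists_normQSq_le Q
  have hρ : 0 ≤ (dilationFactor A)⁻¹ := inv_nonneg.2 (Real.rpow_nonneg (by linarith) _)
  -- `d + 1` instead of `d` makes the constant positive without assuming d ≥ 1.
  refine ⟨√(c⁻¹ * (C * (d + 1))), by positivity, fun n v => ?_⟩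
  refine (sq_le_sq₀ (norm_nonneg _) (by positivity)).1 ?_
  rw [mul_pow, mul_pow, Real.sq_sqrt (by positivity)]
  calc ‖invTranspose A ^ n *ᵥ v‖ ^ 2
      ≤ (invTranspose A ^ n *ᵥ v) ⬝ᵥ (invTranspose A ^ n *ᵥ v) := norm_sq_le_dotProduct _
    _ ≤ c⁻¹ * normQSq Q (invTranspose A ^ n *ᵥ v) := by
        rw [inv_mul_eq_div, le_div_iff₀' hc]; exact h1 _
    _ = c⁻¹ * ((dilationFactor A)⁻¹ ^ (2 * n) * normQSq Q v) := by
        rw [normQSq_invTranspose_pow_mulVec hQ]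
    _ ≤ c⁻¹ * ((dilationFactor A)⁻¹ ^ (2 * n) * (C * ((d + 1) * ‖v‖ ^ 2))) := by
        have := (h2 v).trans (mul_le_mul_of_nonneg_left (dotProduct_le_norm_sq v) hC.le)
        gcongr
        refine this.trans ?_
        gcongr
        linarith
    _ = _ := by ring

lemma realMat_transpose (A : Matrix (Fin d) (Fin d) ℤ) : realMat Aᵀ = (realMat A)ᵀ := rfl

lemma isUnit_det_realMat (h : 1 < absDet A) : IsUnit (realMat A).det := by
  have h1 : ((A.det : ℤ) : ℝ) = (realMat A).det := by
    simpa using RingHom.map_det (Int.castRingHom ℝ) A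
  rw [← h1, isUnit_iff_ne_zero]
  rintro h0
  rw [absDet, h0] at h
  norm_num at h

lemma realMat_mul_invTranspose (h : 1 < absDet A) : realMat Aᵀ * invTranspose A = 1 := by
  rw [realMat_transpose, invTranspose, ← Matrix.transpose_mul,
    Matrix.nonsing_inv_mul _ (isUnit_det_realMat h), Matrix.transpose_one]

lemma invTranspose_mul_realMat (h : 1 < absDet A) : invTranspose A * realMat Aᵀ = 1 := by
  rw [realMat_transpose, invTranspose, ← Matrix.transpose_mul,
    Matrix.mul_nonsing_inv _ (isUnit_det_realMat h), Matrix.transpose_one]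

lemma realMat_mulVec_intCast (B : Matrix (Fin d) (Fin d) ℤ) (k : Fin d → ℤ) :
    realMat B *ᵥ (fun i => (k i : ℝ)) = fun i => ((B *ᵥ k) i : ℝ) := by
  ext i
  simp [Matrix.mulVec, dotProduct]

lemma realMat_mulVec_latticePoint (B : Matrix (Fin d) (Fin d) ℤ) (k : Fin d → ℤ) :
    realMat B *ᵥ latticePoint k = latticePoint (B *ᵥ k) := by
  rw [latticePoint, Matrix.mulVec_smul, realMat_mulVec_intCast, latticePoint]

/-! ### The mask -/

lemma finite_digitPoints (h : 1 < absDet A) : (digitPoints Aᵀ).Finite := by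
  have hK : IsCompact ((fun s => realMat Aᵀ *ᵥ s) '' Set.Icc (0 : Fin d → ℝ) 1) :=
    isCompact_Icc.image (by fun_prop)
  obtain ⟨R, hR⟩ := hK.isBounded.exists_norm_le
  have hfin : ((fun n : Fin d → ℤ => invTranspose A *ᵥ (fun i => (n i : ℝ))) ''
      Set.Icc (fun _ => -⌈R⌉) (fun _ => ⌈R⌉)).Finite :=
    (Set.finite_Icc _ _).image _
  refine hfin.subset fun s hs => ?_
  obtain ⟨hs, n, hn⟩ := hs
  refine ⟨n, ?_, ?_⟩
  · have h1 : ‖realMat Aᵀ *ᵥ s‖ ≤ R :=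
      hR _ ⟨s, ⟨fun i => (hs i).1, fun i => (hs i).2.le⟩, rfl⟩
    have h2 : ∀ i, |n i| ≤ ⌈R⌉ := by
      intro i
      have h3 := (norm_le_pi_norm (realMat Aᵀ *ᵥ s) i).trans h1
      rw [hn, Real.norm_eq_abs] at h3
      have h4 : |(n i : ℝ)| ≤ ⌈R⌉ := h3.trans (Int.le_ceil R)
      exact_mod_cast h4
    exact ⟨fun i => (abs_le.1 (h2 i)).1, fun i => (abs_le.1 (h2 i)).2⟩
  · simp only
    rw [← hn, Matrix.mulVec_mulVec, invTranspose_mul_realMat h, Matrix.one_mulVec]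

open Classical in
/-- The nonzero digit points of `Aᵀ` as a finite set. -/
noncomputable def digitFinset (A : Matrix (Fin d) (Fin d) ℤ) : Finset (Fin d → ℝ) :=
  if h : (digitPoints Aᵀ \ {0}).Finite then h.toFinset else ∅

lemma mem_digitFinset (h : 1 < absDet A) {s : Fin d → ℝ} :
    s ∈ digitFinset A ↔ s ∈ digitPoints Aᵀ ∧ s ≠ 0 := by
  rw [digitFinset, dif_pos (finite_digitPoints h).sdiff]
  simp

/-- The numerator of the mask. -/
noncomputable def maskNum (A : Matrix (Fin d) (Fin d) ℤ) (Q : Matrix (Fin d) (Fin d) ℝ)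
    (ξ : Fin d → ℝ) : ℝ := ∏ s ∈ digitFinset A, G Q (ξ + (2 * Real.pi) • s)

lemma mask_eq (h : 1 < absDet A) (ξ : Fin d → ℝ) :
    mask A Q ξ = maskNum A Q ξ / maskNum A Q 0 := by
  have hf := (finite_digitPoints h).sdiff (t := {0})
  rw [mask, finprod_mem_eq_finite_toFinset_prod _ hf, finprod_mem_eq_finite_toFinset_prod _ hf,
    maskNum, maskNum, digitFinset, dif_pos hf]
  simp only [zero_add]

lemma G_two_pi_smul_pos (hQ : IsSimilarityMatrix A Q) {s : Fin d → ℝ} (hs : s ∈ digitPoints Aᵀ)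
    (h0 : s ≠ 0) : 0 < G Q ((2 * Real.pi) • s) := by
  refine lt_of_le_of_ne (G_nonneg hQ.transpose_eq hQ.isUnit_det _) fun hcon => h0 ?_
  obtain ⟨k, hk⟩ := exists_eq_latticePoint_of_G_eq_zero hQ.transpose_eq hQ.isUnit_det hcon.symm
  have h1 : s = fun i => (k i : ℝ) := smul_right_injective _ Real.two_pi_pos.ne' hk
  ext i
  have h2 := hs.1 i
  rw [h1] at h2 ⊢
  have h3 : (0 : ℝ) ≤ k i := h2.1
  have h4 : (k i : ℝ) < 1 := h2.2
  norm_cast at h3 h4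
  have : k i = 0 := by omega
  simp [this]

lemma maskNum_zero_pos (hQ : IsSimilarityMatrix A Q) (h : 1 < absDet A) : 0 < maskNum A Q 0 := by
  refine Finset.prod_pos fun s hs => ?_
  rw [zero_add]
  rw [mem_digitFinset h] at hs
  exact G_two_pi_smul_pos hQ hs.1 hs.2

lemma maskNum_nonneg (hQ : IsSimilarityMatrix A Q) (ξ : Fin d → ℝ) : 0 ≤ maskNum A Q ξ :=
  Finset.prod_nonneg fun _ _ => G_nonneg hQ.transpose_eq hQ.isUnit_det _

lemma mask_nonneg (hQ : IsSimilarityMatrix A Q) (h : 1 < absDet A) (ξ : Fin d → ℝ) :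
    0 ≤ mask A Q ξ := by
  rw [mask_eq h]
  exact div_nonneg (maskNum_nonneg hQ ξ) (maskNum_nonneg hQ 0)

lemma mask_zero (hQ : IsSimilarityMatrix A Q) (h : 1 < absDet A) : mask A Q 0 = 1 := by
  rw [mask_eq h, div_self (maskNum_zero_pos hQ h).ne']

lemma differentiable_mask (h : 1 < absDet A) : Differentiable ℝ (mask A Q) := by
  have : mask A Q = fun ξ => maskNum A Q ξ / maskNum A Q 0 := funext (mask_eq h)
  have hs : ∀ s ∈ digitFinset A, Differentiable ℝ fun ξ => G Q (ξ + (2 * Real.pi) • s) :=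
    fun s _ => differentiable_G.comp (f := fun ξ : Fin d → ℝ => ξ + (2 * Real.pi) • s)
      (differentiable_id.add_const _)
  have hn : Differentiable ℝ (maskNum A Q) := by
    classical
    exact fun ξ => (HasFDerivAt.finsetProd fun s h' => (hs s h' ξ).hasFDerivAt).differentiableAt
  simp only [this, div_eq_mul_inv]
  exact hn.mul_const _

lemma exists_G_le (hQ : Qᵀ = Q) : ∃ C : ℝ, 0 < C ∧ ∀ ξ, G Q ξ ≤ C := by
  obtain ⟨C, hC, h⟩ := exists_G_le_laplaceSymbol hQ
  exact ⟨C * (4 * (d + 1)), by positivity, fun ξ => (h ξ).trans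
    (mul_le_mul_of_nonneg_left ((laplaceSymbol_le ξ).trans (by linarith)) hC.le)⟩

lemma exists_mask_le (hQ : IsSimilarityMatrix A Q) (h : 1 < absDet A) :
    ∃ C : ℝ, 0 < C ∧ ∀ ξ, mask A Q ξ ≤ C := by
  obtain ⟨C, hC, hG⟩ := exists_G_le hQ.transpose_eq
  have h0 := maskNum_zero_pos hQ h
  refine ⟨C ^ (digitFinset A).card / maskNum A Q 0, by positivity, fun ξ => ?_⟩
  rw [mask_eq h]
  gcongr
  exact (Finset.prod_le_prod (fun _ _ => G_nonneg hQ.transpose_eq hQ.isUnit_det _)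
    fun s _ => hG _).trans_eq (Finset.prod_const _)

/-- Near 0 this is differentiability of the mask together with m₀(0) = 1; away from 0 it is
boundedness of the mask. -/
lemma exists_abs_mask_sub_one_le (hQ : IsSimilarityMatrix A Q) (h : 1 < absDet A) :
    ∃ C : ℝ, 0 < C ∧ ∀ ξ, |mask A Q ξ - 1| ≤ C * ‖ξ‖ := by
  obtain ⟨M, hM, hmask⟩ := exists_mask_le hQ h
  have hO := ((differentiable_mask (Q := Q) h) 0).isBigO_sub
  obtain ⟨c, hc⟩ := hO.bound
  obtain ⟨δ, hδ, hball⟩ := Metric.eventually_nhds_iff.1 hc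
  simp only [sub_zero, mask_zero hQ h, dist_zero_right, Real.norm_eq_abs] at hball
  refine ⟨max c ((M + 1) / δ), lt_max_of_lt_right (by positivity), fun ξ => ?_⟩
  rcases lt_or_ge ‖ξ‖ δ with h1 | h1
  · exact (hball h1).trans (mul_le_mul_of_nonneg_right (le_max_left _ _) (norm_nonneg _))
  · have h2 : |mask A Q ξ - 1| ≤ M + 1 := by
      rw [abs_le]
      constructor <;> linarith [hmask ξ, mask_nonneg hQ h ξ]
    calc |mask A Q ξ - 1| ≤ (M + 1) / δ * δ := by rw [div_mul_cancel₀ _ hδ.ne']; exact h2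
      _ ≤ max c ((M + 1) / δ) * ‖ξ‖ := by
        gcongr
        exact le_max_right _ _

lemma exists_eq_latticePoint_of_mask_eq_zero (hQ : IsSimilarityMatrix A Q) (h : 1 < absDet A)
    {ξ : Fin d → ℝ} (h0 : mask A Q ξ = 0) : ∃ k, realMat Aᵀ *ᵥ ξ = latticePoint k := by
  rw [mask_eq h, div_eq_zero_iff, or_iff_left (maskNum_zero_pos hQ h).ne', maskNum,
    Finset.prod_eq_zero_iff] at h0
  obtain ⟨s, hs, hG⟩ := h0
  rw [mem_digitFinset h] at hs
  obtain ⟨n, hn⟩ := hs.1.2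
  obtain ⟨k, hk⟩ := exists_eq_latticePoint_of_G_eq_zero hQ.transpose_eq hQ.isUnit_det hG
  refine ⟨Aᵀ *ᵥ k - n, ?_⟩
  have h1 : ξ = latticePoint k - (2 * Real.pi) • s := eq_sub_of_add_eq hk
  rw [h1, Matrix.mulVec_sub, realMat_mulVec_latticePoint, Matrix.mulVec_smul, hn]
  ext i
  simp [latticePoint]
  ring

/-- The digit point is the coordinatewise fractional part of -A^{-T}k, which moves A^{-T}k to an
integer vector. -/
lemma exists_digitPoint_add (h : 1 < absDet A) (k : Fin d → ℤ) :
    ∃ s ∈ digitPoints Aᵀ, ∃ l, invTranspose A *ᵥ latticePoint k + (2 * Real.pi) • s =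
      latticePoint l := by
  set v := invTranspose A *ᵥ (fun i => (k i : ℝ)) with hv
  have hmul : realMat Aᵀ *ᵥ v = fun i => (k i : ℝ) := by
    rw [hv, Matrix.mulVec_mulVec, realMat_mul_invTranspose h, Matrix.one_mulVec]
  have hs : (fun i => Int.fract (-v i)) = -v - (fun i => ((⌊-v i⌋ : ℤ) : ℝ)) := rfl
  refine ⟨fun i => Int.fract (-v i), ⟨fun i => ⟨Int.fract_nonneg _, Int.fract_lt_one _⟩,
    -k - Aᵀ *ᵥ (fun i => ⌊-v i⌋), ?_⟩, fun i => -⌊-v i⌋, ?_⟩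
  · rw [hs, Matrix.mulVec_sub, Matrix.mulVec_neg, hmul, realMat_mulVec_intCast]
    ext i
    simp
  · rw [latticePoint, Matrix.mulVec_smul, ← hv, hs, latticePoint, ← smul_add]
    congr 1
    ext i
    simp only [Pi.add_apply, Pi.sub_apply, Pi.neg_apply, Int.cast_neg]
    ring

/-! ### Boundedness of `μ` -/

/-- Up to a constant, m₀G is the product of G(· + 2πs) over all of S. Write ξ = ζ + 2πk with ζ in
the cube [-π,π]^d. Some s cancels A^{-T}(2πk) modulo 2πℤ^d, so its factor is G(A^{-T}ζ) ≲ |ζ|² ≲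
G(ζ) = G(ξ); the other factors are bounded. -/
lemma exists_mask_mul_G_le (hQ : IsSimilarityMatrix A Q) (h : 1 < absDet A) :
    ∃ C : ℝ, 0 < C ∧ ∀ ξ, mask A Q (invTranspose A *ᵥ ξ) * G Q (invTranspose A *ᵥ ξ) ≤
      C * G Q ξ := by
  classical
  obtain ⟨Cm, hCm, hm⟩ := exists_G_le hQ.transpose_eq
  obtain ⟨C1, hC1, h1⟩ := exists_G_le_laplaceSymbol hQ.transpose_eq
  obtain ⟨c2, hc2, h2⟩ := exists_laplaceSymbol_le_G hQ.transpose_eq hQ.isUnit_det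
  obtain ⟨C3, hC3, h3⟩ := exists_mulVec_dotProduct_le (invTranspose A)
  have h0 := maskNum_zero_pos hQ h
  have hpi := Real.pi_pos
  have hnn := G_nonneg hQ.transpose_eq hQ.isUnit_det
  set S := digitFinset A with hS
  have hzero : ∀ ξ, mask A Q ξ * G Q ξ =
      (∏ s ∈ insert 0 S, G Q (ξ + (2 * Real.pi) • s)) / maskNum A Q 0 := by
    intro ξ
    rw [mask_eq h, Finset.prod_insert (by simp [hS, mem_digitFinset h]), maskNum]
    simp only [smul_zero, add_zero]
    ring
  refine ⟨C1 * C3 * (Real.pi ^ 2 / 4) / c2 * Cm ^ S.card / maskNum A Q 0, by positivity,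
    fun ξ => ?_⟩
  obtain ⟨ζ, k, rfl, hζ⟩ := exists_eq_add_latticePoint ξ
  obtain ⟨s, hs, l, hl⟩ := exists_digitPoint_add h k
  have hsmem : s ∈ insert 0 S := by
    rw [Finset.mem_insert, hS, mem_digitFinset h]
    by_cases hs0 : s = 0
    · exact Or.inl hs0
    · exact Or.inr ⟨hs, hs0⟩
  have hfac : G Q (invTranspose A *ᵥ (ζ + latticePoint k) + (2 * Real.pi) • s) ≤
      C1 * C3 * (Real.pi ^ 2 / 4) / c2 * G Q (ζ + latticePoint k) := by
    rw [Matrix.mulVec_add, add_assoc, hl, G_add_latticePoint, G_add_latticePoint]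
    calc G Q (invTranspose A *ᵥ ζ) ≤ C1 * laplaceSymbol (invTranspose A *ᵥ ζ) := h1 _
      _ ≤ C1 * (C3 * (ζ ⬝ᵥ ζ)) := by
        gcongr
        exact (laplaceSymbol_le_dotProduct _).trans (h3 ζ)
      _ = C1 * C3 * (Real.pi ^ 2 / 4) / c2 * (c2 * (4 / Real.pi ^ 2 * (ζ ⬝ᵥ ζ))) := by
        field_simp
      _ ≤ C1 * C3 * (Real.pi ^ 2 / 4) / c2 * G Q ζ := by
        gcongr
        refine le_trans ?_ (h2 ζ)
        gcongr
        exact dotProduct_le_laplaceSymbol hζ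
  have hcard : ((insert 0 S).erase s).card = S.card := by
    rw [Finset.card_erase_of_mem hsmem, Finset.card_insert_of_notMem
      (by simp [hS, mem_digitFinset h]), Nat.add_sub_cancel]
  rw [hzero, div_mul_eq_mul_div]
  refine div_le_div_of_nonneg_right ?_ h0.le
  rw [← Finset.mul_prod_erase _ _ hsmem, mul_right_comm]
  refine mul_le_mul hfac ?_ (Finset.prod_nonneg fun _ _ => hnn _) ((hnn _).trans hfac)
  rw [← hcard]
  exact (Finset.prod_le_prod (fun _ _ => hnn _) fun s _ => hm _).trans_eq (Finset.prod_const _)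

/-- Without this the real supremum `supMu` would take its default value 0 and would bound nothing.
-/
lemma bddAbove_range_mu (hQ : IsSimilarityMatrix A Q) (h : 1 < absDet A) :
    BddAbove (Set.range (mu A Q)) := by
  obtain ⟨C, hC, hle⟩ := exists_mask_mul_G_le hQ h
  refine ⟨max 1 (absDet A ^ (2 / (d : ℝ)) * C), ?_⟩
  rintro _ ⟨ξ, rfl⟩
  rw [mu]
  split_ifs with h0
  · exact le_max_left _ _
  · refine le_trans ?_ (le_max_right _ _)
    have hpos := lt_of_le_of_ne (G_nonneg hQ.transpose_eq hQ.isUnit_det ξ) (Ne.symm h0)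
    rw [div_le_iff₀ hpos, mul_assoc, mul_assoc]
    exact mul_le_mul_of_nonneg_left (hle ξ) (Real.rpow_nonneg (by linarith) _)

lemma one_le_supMu (hQ : IsSimilarityMatrix A Q) (h : 1 < absDet A) : 1 ≤ supMu A Q := by
  refine le_trans ?_ (le_ciSup (bddAbove_range_mu hQ h) 0)
  rw [mu, if_pos G_zero]

lemma mask_mul_G_le (hQ : IsSimilarityMatrix A Q) (h : 1 < absDet A) (ξ : Fin d → ℝ) :
    mask A Q (invTranspose A *ᵥ ξ) * G Q (invTranspose A *ᵥ ξ) ≤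
      supMu A Q * (dilationFactor A)⁻¹ ^ 2 * G Q ξ := by
  have hq : 0 < absDet A ^ (2 / (d : ℝ)) := Real.rpow_pos_of_pos (by linarith) _
  have hnn := G_nonneg hQ.transpose_eq hQ.isUnit_det ξ
  rcases hnn.eq_or_lt with h0 | hpos
  -- At a zero of G the prescribed value 1 of `mu` carries no information; the unnormalised bound
  -- shows that the left side is at most 0.
  · obtain ⟨C, hC, hle⟩ := exists_mask_mul_G_le hQ h
    have := hle ξ
    rw [← h0, mul_zero] at this ⊢
    exact this
  · have := le_ciSup (bddAbove_range_mu hQ h) ξ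
    rw [mu, if_neg hpos.ne', div_le_iff₀ hpos, mul_assoc] at this
    rw [inv_pow, dilationFactor_sq h]
    calc _ = (absDet A ^ (2 / (d : ℝ)))⁻¹ * (absDet A ^ (2 / (d : ℝ)) *
          (mask A Q (invTranspose A *ᵥ ξ) * G Q (invTranspose A *ᵥ ξ))) := by field_simp
      _ ≤ (absDet A ^ (2 / (d : ℝ)))⁻¹ * (supMu A Q * G Q ξ) :=
          mul_le_mul_of_nonneg_left this (by positivity)
      _ = _ := by ring

/-! ### The infinite product -/

lemma exists_abs_mask_pow_sub_one_le (hd : 1 ≤ d) (hQ : IsSimilarityMatrix A Q)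
    (h : 1 < absDet A) : ∃ C : ℝ, 0 < C ∧ ∀ ξ (j : ℕ),
      |mask A Q (invTranspose A ^ (j + 1) *ᵥ ξ) - 1| ≤ C * ‖ξ‖ * (dilationFactor A)⁻¹ ^ j := by
  obtain ⟨C1, hC1, h1⟩ := exists_abs_mask_sub_one_le hQ h
  obtain ⟨C2, hC2, h2⟩ := exists_norm_invTranspose_pow_mulVec_le hQ h
  have hρ := one_lt_dilationFactor hd h
  refine ⟨C1 * C2, by positivity, fun ξ j => ?_⟩
  calc _ ≤ C1 * ‖invTranspose A ^ (j + 1) *ᵥ ξ‖ := h1 _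
    _ ≤ C1 * (C2 * (dilationFactor A)⁻¹ ^ (j + 1) * ‖ξ‖) := by gcongr; exact h2 _ _
    _ ≤ C1 * (C2 * (dilationFactor A)⁻¹ ^ j * ‖ξ‖) := by
        have : (dilationFactor A)⁻¹ ^ (j + 1) ≤ (dilationFactor A)⁻¹ ^ j :=
          pow_le_pow_of_le_one (by positivity) (inv_le_one_of_one_le₀ hρ.le) (Nat.le_succ j)
        gcongr
    _ = _ := by ring

lemma summable_geometric_dilationFactor (hd : 1 ≤ d) (h : 1 < absDet A) (c : ℝ) :
    Summable fun j : ℕ => c * (dilationFactor A)⁻¹ ^ j := by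
  have hρ := one_lt_dilationFactor hd h
  exact (summable_geometric_of_lt_one (by positivity) (inv_lt_one_of_one_lt₀ hρ)).mul_left c

lemma summable_mask_sub_one (hd : 1 ≤ d) (hQ : IsSimilarityMatrix A Q) (h : 1 < absDet A)
    (ξ : Fin d → ℝ) :
    Summable fun j : ℕ => ‖mask A Q (invTranspose A ^ (j + 1) *ᵥ ξ) - 1‖ := by
  obtain ⟨C, hC, hle⟩ := exists_abs_mask_pow_sub_one_le hd hQ h
  exact (summable_geometric_dilationFactor hd h (C * ‖ξ‖)).of_nonneg_of_le
    (fun _ => norm_nonneg _) fun j => hle ξ j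

lemma phiHat_eq_tprod_one_add (ξ : Fin d → ℝ) :
    phiHat A Q ξ = ∏' j : ℕ, (1 + (mask A Q (invTranspose A ^ (j + 1) *ᵥ ξ) - 1)) := by
  simp only [phiHat, add_sub_cancel]

lemma multipliable_mask (hd : 1 ≤ d) (hQ : IsSimilarityMatrix A Q) (h : 1 < absDet A)
    (ξ : Fin d → ℝ) : Multipliable fun j : ℕ => mask A Q (invTranspose A ^ (j + 1) *ᵥ ξ) := by
  simpa only [add_sub_cancel] using
    multipliable_one_add_of_summable (summable_mask_sub_one hd hQ h ξ)

lemma continuous_phiHat (hd : 1 ≤ d) (hQ : IsSimilarityMatrix A Q) (h : 1 < absDet A) :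
    Continuous (phiHat A Q) := by
  obtain ⟨C, hC, hle⟩ := exists_abs_mask_pow_sub_one_le hd hQ h
  have hc : Continuous (mask A Q) := (differentiable_mask h).continuous
  refine continuous_iff_continuousAt.2 fun ξ => ?_
  have hb : ∀ᶠ ζ in nhds ξ, ‖ζ‖ < ‖ξ‖ + 1 :=
    continuous_norm.continuousAt.eventually_lt_const (lt_add_one _)
  rw [ContinuousAt, phiHat_eq_tprod_one_add]
  refine Filter.Tendsto.congr (fun ζ => (phiHat_eq_tprod_one_add ζ).symm)
    (tendsto_tprod_one_add_of_dominated_convergence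
      (summable_geometric_dilationFactor hd h (C * (‖ξ‖ + 1)))
      (fun j => Continuous.tendsto (by fun_prop) ξ) ?_)
  filter_upwards [hb] with ζ hζ j
  refine (hle ζ j).trans ?_
  have hρ := one_lt_dilationFactor hd h
  gcongr

lemma phiHat_zero (hQ : IsSimilarityMatrix A Q) (h : 1 < absDet A) : phiHat A Q 0 = 1 := by
  simp [phiHat, mask_zero hQ h]

lemma phiHat_nonneg (hQ : IsSimilarityMatrix A Q) (h : 1 < absDet A) (ξ : Fin d → ℝ) :
    0 ≤ phiHat A Q ξ :=
  tprod_nonneg fun _ => mask_nonneg hQ h _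

/-- An absolutely convergent product vanishes only if a factor does. A vanishing factor puts some
iterate of ξ under A^{-T} on 2πℤ^d, and applying the integer matrix Aᵀ repeatedly brings ξ itself
there. -/
lemma phiHat_pos (hd : 1 ≤ d) (hQ : IsSimilarityMatrix A Q) (h : 1 < absDet A) {ξ : Fin d → ℝ}
    (hξ : ∀ k, ξ ≠ latticePoint k) : 0 < phiHat A Q ξ := by
  refine lt_of_le_of_ne (phiHat_nonneg hQ h ξ) (Ne.symm ?_)
  rw [phiHat_eq_tprod_one_add]
  refine tprod_one_add_ne_zero_of_summable (fun j => ?_) (summable_mask_sub_one hd hQ h ξ)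
  rw [add_sub_cancel]
  intro h0
  obtain ⟨k, hk⟩ := exists_eq_latticePoint_of_mask_eq_zero hQ h h0
  rw [pow_succ', Matrix.mulVec_mulVec, ← Matrix.mul_assoc, realMat_mul_invTranspose h,
    Matrix.one_mul] at hk
  have key : ∀ (n : ℕ) (l : Fin d → ℤ), invTranspose A ^ n *ᵥ ξ = latticePoint l →
      ∃ l', ξ = latticePoint l' := by
    intro n
    induction n with
    | zero => intro l hl; exact ⟨l, by simpa using hl⟩
    | succ n ih =>
      intro l hl
      refine ih (Aᵀ *ᵥ l) ?_
      rw [← realMat_mulVec_latticePoint, ← hl, pow_succ', Matrix.mulVec_mulVec,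
        ← Matrix.mul_assoc, realMat_mul_invTranspose h, Matrix.one_mul]
  obtain ⟨l, hl⟩ := key j k hk
  exact hξ l hl

lemma phiHat_eq_prod_mul (hd : 1 ≤ d) (hQ : IsSimilarityMatrix A Q) (h : 1 < absDet A)
    (n : ℕ) (ξ : Fin d → ℝ) :
    phiHat A Q ξ = (∏ j ∈ Finset.range n, mask A Q (invTranspose A ^ (j + 1) *ᵥ ξ)) *
      phiHat A Q (invTranspose A ^ n *ᵥ ξ) := by
  have h1 : ∀ j, invTranspose A ^ (j + 1) *ᵥ (invTranspose A ^ n *ᵥ ξ) =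
      invTranspose A ^ (j + n + 1) *ᵥ ξ := fun j => by
    rw [Matrix.mulVec_mulVec, ← pow_add]; congr 2; ring
  have h2 := multipliable_mask hd hQ h (invTranspose A ^ n *ᵥ ξ)
  simp only [h1] at h2
  rw [phiHat, phiHat]
  simp only [h1]
  exact (Multipliable.prod_mul_tprod_nat_mul'
    (f := fun j => mask A Q (invTranspose A ^ (j + 1) *ᵥ ξ)) h2).symm

lemma prod_mask_mul_G_le (hQ : IsSimilarityMatrix A Q) (h : 1 < absDet A) (n : ℕ)
    (ξ : Fin d → ℝ) :
    (∏ j ∈ Finset.range n, mask A Q (invTranspose A ^ (j + 1) *ᵥ ξ)) *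
      G Q (invTranspose A ^ n *ᵥ ξ) ≤ (supMu A Q * (dilationFactor A)⁻¹ ^ 2) ^ n * G Q ξ := by
  have hB := one_le_supMu hQ h
  induction n with
  | zero => simp
  | succ n ih =>
    have h1 := mask_mul_G_le hQ h (invTranspose A ^ n *ᵥ ξ)
    rw [Matrix.mulVec_mulVec, ← pow_succ'] at h1
    rw [Finset.prod_range_succ, mul_assoc]
    calc _ ≤ (∏ j ∈ Finset.range n, mask A Q (invTranspose A ^ (j + 1) *ᵥ ξ)) *
          (supMu A Q * (dilationFactor A)⁻¹ ^ 2 * G Q (invTranspose A ^ n *ᵥ ξ)) :=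
          mul_le_mul_of_nonneg_left h1 (Finset.prod_nonneg fun _ _ => mask_nonneg hQ h _)
      _ = supMu A Q * (dilationFactor A)⁻¹ ^ 2 *
          ((∏ j ∈ Finset.range n, mask A Q (invTranspose A ^ (j + 1) *ᵥ ξ)) *
            G Q (invTranspose A ^ n *ᵥ ξ)) := by ring
      _ ≤ supMu A Q * (dilationFactor A)⁻¹ ^ 2 *
          ((supMu A Q * (dilationFactor A)⁻¹ ^ 2) ^ n * G Q ξ) := by gcongr
      _ = _ := by ring

/-! ### Decay of the infinite product -/

/-- The hypothesis reads κ < q^{-1/(2m)}; its 2m-th power is κ^{2m} < q^{-1} = ρ^{-d}, and τ is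
-log_ρ of the left side. -/
lemma exists_decay_exponent (hd : 1 ≤ d) (hQ : IsSimilarityMatrix A Q) (h : 1 < absDet A)
    {m : ℕ} (hm : 1 ≤ m) (hB : supMu A Q < absDet A ^ (2 / (d : ℝ) - 1 / (2 * (m : ℝ)))) :
    ∃ τ : ℝ, d < τ ∧
      (supMu A Q * (dilationFactor A)⁻¹ ^ 2) ^ (2 * m) = dilationFactor A ^ (-τ) := by
  have hρ := one_lt_dilationFactor hd h
  have hρ0 : 0 < dilationFactor A := by linarith
  have hq : 0 < absDet A := by linarith
  have hB1 := one_le_supMu hQ h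
  set κ := supMu A Q * (dilationFactor A)⁻¹ ^ 2 with hκ
  have hκ0 : 0 < κ := by positivity
  have hd0 : (d : ℝ) ≠ 0 := by positivity
  have hm0 : (m : ℝ) ≠ 0 := by positivity
  have h1 : κ < absDet A ^ (-(1 / (2 * (m : ℝ)))) := by
    rw [hκ, inv_pow, dilationFactor_sq h, ← Real.rpow_neg hq.le]
    calc _ < absDet A ^ (2 / (d : ℝ) - 1 / (2 * (m : ℝ))) * absDet A ^ (-(2 / (d : ℝ))) := by
          gcongr
      _ = _ := by rw [← Real.rpow_add hq]; congr 1; ring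
  have h2 : κ ^ (2 * m) < dilationFactor A ^ (-(d : ℝ)) := by
    calc κ ^ (2 * m) < (absDet A ^ (-(1 / (2 * (m : ℝ))))) ^ (2 * m) := by
          gcongr
      _ = dilationFactor A ^ (-(d : ℝ)) := by
          rw [← Real.rpow_natCast, ← Real.rpow_mul hq.le, dilationFactor, ← Real.rpow_mul hq.le]
          congr 1
          push_cast
          field_simp
  refine ⟨-Real.logb (dilationFactor A) (κ ^ (2 * m)), ?_, ?_⟩
  · have := (Real.logb_lt_iff_lt_rpow hρ (by positivity)).2 h2
    linarith
  · rw [neg_neg, Real.rpow_logb hρ0 hρ.ne' (by positivity)]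

lemma exists_phiHat_decay (hd : 1 ≤ d) (hQ : IsSimilarityMatrix A Q) (h : 1 < absDet A)
    {m : ℕ} (hm : 1 ≤ m) (hB : supMu A Q < absDet A ^ (2 / (d : ℝ) - 1 / (2 * (m : ℝ)))) :
    ∃ C τ : ℝ, 0 < C ∧ d < τ ∧ ∀ ξ, (phiHat A Q ξ ^ m) ^ 2 ≤ C * (1 + ‖ξ‖) ^ (-τ) := by
  obtain ⟨τ, hτ, hκτ⟩ := exists_decay_exponent hd hQ h hm hB
  have hτ0 : 0 < τ := lt_of_le_of_lt (Nat.cast_nonneg d) hτ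
  have hρ := one_lt_dilationFactor hd h
  have hB1 := one_le_supMu hQ h
  set ρ := dilationFactor A with hρdef
  have hρ0 : 0 < ρ := by linarith
  set κ := supMu A Q * ρ⁻¹ ^ 2 with hκ
  have hκ0 : 0 < κ := by positivity
  have hpi := Real.pi_pos
  obtain ⟨c1, hc1, hlow⟩ := exists_le_normQSq hQ.isUnit_det
  obtain ⟨C1, hC1, hupp⟩ := exists_normQSq_le Q
  obtain ⟨c2, hc2, hGlow⟩ := exists_laplaceSymbol_le_G hQ.transpose_eq hQ.isUnit_det
  obtain ⟨C2, hC2, hGupp⟩ := exists_G_le hQ.transpose_eq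
  obtain ⟨P, hP⟩ := (isCompact_closedBall (0 : Fin d → ℝ) Real.pi).bddAbove_image
    (continuous_phiHat hd hQ h).continuousOn
  have hP : ∀ ξ, ‖ξ‖ ≤ Real.pi → phiHat A Q ξ ≤ P := fun ξ hξ =>
    hP ⟨ξ, by simpa using hξ, rfl⟩
  have hP1 : 1 ≤ P := by simpa [phiHat_zero hQ h] using hP 0 (by simpa using hpi.le)
  have hnorm : ∀ v, √c1 * ‖v‖ ≤ √(normQSq Q v) := fun v => by
    rw [← Real.sqrt_sq (norm_nonneg v), ← Real.sqrt_mul hc1.le]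
    exact Real.sqrt_le_sqrt ((mul_le_mul_of_nonneg_left (norm_sq_le_dotProduct v) hc1.le).trans
      (hlow v))
  have hsc : 0 < √c1 := Real.sqrt_pos.2 hc1
  -- Chosen so that |Qv| ≤ rρ forces ‖v‖ ≤ π: the annulus r ≤ |Qv| ≤ rρ, one dilation step wide,
  -- lies in the cube where G is quadratic from below.
  set r := √c1 * Real.pi / ρ with hr
  have hr0 : 0 < r := by positivity
  have hrρ : r * ρ = √c1 * Real.pi := by rw [hr]; field_simp
  have hsmall : ∀ v, √(normQSq Q v) ≤ r * ρ → ‖v‖ ≤ Real.pi := fun v hv => by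
    rw [hrρ] at hv
    exact le_of_mul_le_mul_left ((hnorm v).trans hv) hsc
  set g := c2 * (4 / Real.pi ^ 2 * (r ^ 2 / C1)) with hg
  have hg0 : 0 < g := by positivity
  have hGg : ∀ v, r ≤ √(normQSq Q v) → ‖v‖ ≤ Real.pi → g ≤ G Q v := fun v hv hv' => by
    refine le_trans ?_ (hGlow v)
    rw [hg]
    gcongr
    refine le_trans ?_ (dotProduct_le_laplaceSymbol hv')
    gcongr
    rw [div_le_iff₀' hC1]
    refine le_trans ?_ (hupp v)
    exact (Real.le_sqrt' hr0).1 hv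
  set a := √c1 / r with ha
  have ha0 : 0 < a := by positivity
  set δ := 1 / (ρ * (1 + 1 / a)) with hδ
  have hδ0 : 0 < δ := by positivity
  set K := ((C2 / g * P) ^ m) ^ 2 with hK
  -- The first summand covers |Qξ| < r, where φ̂ ≤ P; the second covers the rest.
  refine ⟨(P ^ m) ^ 2 * (1 + Real.pi) ^ τ + K * δ ^ (-τ), τ, by positivity, hτ, fun ξ => ?_⟩
  have hφ0 := phiHat_nonneg hQ h ξ
  have hx1 : 0 < 1 + ‖ξ‖ := by positivity
  rw [add_mul]
  rcases lt_or_ge (√(normQSq Q ξ)) r with hlt | hge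
  · have hξ : ‖ξ‖ ≤ Real.pi := hsmall ξ (by nlinarith)
    refine le_add_of_le_of_nonneg ?_ (by positivity)
    have h1 : 1 ≤ (1 + Real.pi) ^ τ * (1 + ‖ξ‖) ^ (-τ) := by
      rw [Real.rpow_neg hx1.le, ← div_eq_mul_inv, one_le_div (by positivity)]
      gcongr
    calc (phiHat A Q ξ ^ m) ^ 2 ≤ (P ^ m) ^ 2 := by gcongr; exact hP ξ hξ
      _ ≤ (P ^ m) ^ 2 * ((1 + Real.pi) ^ τ * (1 + ‖ξ‖) ^ (-τ)) :=
        le_mul_of_one_le_right (by positivity) h1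
      _ = _ := by ring
  · refine le_add_of_nonneg_of_le (by positivity) ?_
    have hx : 1 ≤ √(normQSq Q ξ) / r := (one_le_div hr0).2 hge
    -- ρ^n ≤ |Qξ|/r < ρ^{n+1}, so the n-th iterate of ξ lands in the annulus.
    obtain ⟨n, hn1, hn2⟩ := exists_nat_pow_near hx hρ
    set x := √(normQSq Q ξ) / r with hxdef
    have hxr : √(normQSq Q ξ) = x * r := by rw [hxdef]; field_simp
    have hη : √(normQSq Q (invTranspose A ^ n *ᵥ ξ)) = (ρ ^ n)⁻¹ * (x * r) := by
      rw [normQSq_invTranspose_pow_mulVec hQ, ← hρdef, mul_comm 2 n, pow_mul,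
        Real.sqrt_mul (by positivity), Real.sqrt_sq (by positivity), hxr, inv_pow]
    have hη1 : r ≤ √(normQSq Q (invTranspose A ^ n *ᵥ ξ)) := by
      rw [hη, le_inv_mul_iff₀ (by positivity)]
      gcongr
    have hη2 : ‖invTranspose A ^ n *ᵥ ξ‖ ≤ Real.pi := by
      refine hsmall _ ?_
      rw [hη, inv_mul_le_iff₀ (by positivity)]
      calc x * r ≤ ρ ^ (n + 1) * r := by gcongr
        _ = _ := by ring
    have hprod : ∏ j ∈ Finset.range n, mask A Q (invTranspose A ^ (j + 1) *ᵥ ξ) ≤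
        κ ^ n * (C2 / g) := by
      have hpn : 0 ≤ ∏ j ∈ Finset.range n, mask A Q (invTranspose A ^ (j + 1) *ᵥ ξ) :=
        Finset.prod_nonneg fun _ _ => mask_nonneg hQ h _
      rw [← mul_div_assoc, le_div_iff₀ hg0]
      calc _ ≤ (∏ j ∈ Finset.range n, mask A Q (invTranspose A ^ (j + 1) *ᵥ ξ)) *
            G Q (invTranspose A ^ n *ᵥ ξ) := by gcongr; exact hGg _ hη1 hη2
        _ ≤ κ ^ n * G Q ξ := prod_mask_mul_G_le hQ h n ξ
        _ ≤ κ ^ n * C2 := by gcongr; exact hGupp ξ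
    have hφ : phiHat A Q ξ ≤ κ ^ n * (C2 / g * P) := by
      rw [phiHat_eq_prod_mul hd hQ h n ξ, ← mul_assoc]
      exact mul_le_mul hprod (hP _ hη2) (phiHat_nonneg hQ h _) (by positivity)
    have hδx : δ * (1 + ‖ξ‖) ≤ ρ ^ n := by
      have h1 : ‖ξ‖ ≤ x / a := by
        rw [le_div_iff₀ ha0, hxdef, ha, ← mul_div_assoc]
        gcongr
        rw [mul_comm]
        exact hnorm ξ
      rw [hδ, one_div_mul_eq_div, div_le_iff₀ (by positivity)]
      calc 1 + ‖ξ‖ ≤ x + x / a := by gcongr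
        _ = x * (1 + 1 / a) := by ring
        _ ≤ ρ ^ (n + 1) * (1 + 1 / a) := by gcongr
        _ = _ := by ring
    calc (phiHat A Q ξ ^ m) ^ 2 ≤ ((κ ^ n * (C2 / g * P)) ^ m) ^ 2 := by gcongr
      _ = K * (κ ^ (2 * m)) ^ n := by rw [hK]; ring
      _ = K * (ρ ^ n) ^ (-τ) := by
        rw [hκτ, ← Real.rpow_natCast, ← Real.rpow_natCast, ← Real.rpow_mul hρ0.le,
          ← Real.rpow_mul hρ0.le, mul_comm (-τ)]
      _ ≤ K * (δ * (1 + ‖ξ‖)) ^ (-τ) := by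
        gcongr K * ?_
        exact Real.rpow_le_rpow_of_nonpos (by positivity) hδx (by linarith)
      _ = _ := by rw [Real.mul_rpow hδ0.le hx1.le]; ring

/-! ### Summation over the lattice -/

lemma summable_one_add_norm_rpow {τ : ℝ} (hτ : d < τ) :
    Summable fun k : Fin d → ℤ => (1 + ‖(fun i => (k i : ℝ) : Fin d → ℝ)‖) ^ (-τ) := by
  have hτ0 : 0 < τ := lt_of_le_of_lt (Nat.cast_nonneg d) hτ
  set L : Submodule ℤ (Fin d → ℝ) := Submodule.span ℤ (Set.range (Pi.basisFun ℝ (Fin d))) with hL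
  have hrank : Module.finrank ℤ L = d := by
    rw [hL, ZLattice.rank ℝ, Module.finrank_fin_fun]
  have h1 : Summable fun z : L => ‖(z : Fin d → ℝ)‖ ^ (-τ) :=
    ZLattice.summable_norm_rpow L (-τ) (by rw [hrank]; linarith)
  have hmem : ∀ k : Fin d → ℤ, (fun i => (k i : ℝ) : Fin d → ℝ) ∈ L := fun k => by
    rw [hL]
    refine ((Pi.basisFun ℝ (Fin d)).mem_span_iff_repr_mem ℤ _).2 fun i => ⟨k i, by simp⟩
  clear_value L
  have h2 : Summable fun k : Fin d → ℤ => ‖(fun i => (k i : ℝ) : Fin d → ℝ)‖ ^ (-τ) := by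
    let e : (Fin d → ℤ) → L := fun k => ⟨fun i => (k i : ℝ), hmem k⟩
    have he : Function.Injective e := fun k l hkl => by
      have := congrArg Subtype.val hkl
      ext i
      exact Int.cast_injective (congrFun this i)
    have h2 := h1.comp_injective he
    simpa only [Function.comp_def, e] using h2
  refine h2.of_norm_bounded_eventually ?_
  -- k = 0 must be left out: there ‖k‖^{-τ} is 0 by convention, while the term to be bounded is 1.
  filter_upwards [(Set.finite_singleton (0 : Fin d → ℤ)).compl_mem_cofinite] with k hk
  have hk0 : 0 < ‖(fun i => (k i : ℝ) : Fin d → ℝ)‖ := by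
    rw [norm_pos_iff]
    intro h0
    refine hk (funext fun i => ?_)
    have := congrFun h0 i
    simpa using this
  rw [Real.norm_of_nonneg (by positivity)]
  exact Real.rpow_le_rpow_of_nonpos hk0 (by linarith) (by linarith)

lemma one_add_norm_le_mul (ξ : Fin d → ℝ) (k : Fin d → ℤ) :
    1 + ‖(fun i => (k i : ℝ) : Fin d → ℝ)‖ ≤ (1 + ‖ξ‖) * (1 + ‖ξ + latticePoint k‖) := by
  have h1 : ‖latticePoint k‖ = 2 * Real.pi * ‖(fun i => (k i : ℝ) : Fin d → ℝ)‖ := by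
    rw [latticePoint, norm_smul, Real.norm_of_nonneg Real.two_pi_pos.le]
  have h2 : ‖latticePoint k‖ ≤ ‖ξ + latticePoint k‖ + ‖ξ‖ := by
    simpa using norm_sub_le (ξ + latticePoint k) ξ
  have h3 := norm_nonneg (fun i => (k i : ℝ) : Fin d → ℝ)
  have h4 := mul_nonneg (norm_nonneg ξ) (norm_nonneg (ξ + latticePoint k))
  nlinarith [Real.pi_gt_three]

/-- A Peetre-type inequality trades (1 + ‖ξ + 2πk‖)^{-τ} for (1 + ‖k‖)^{-τ} at the cost of (1 +
R)^τ, and τ > d makes this summable. -/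
lemma exists_phiHat_add_latticePoint_le (hd : 1 ≤ d) (hQ : IsSimilarityMatrix A Q)
    (h : 1 < absDet A) {m : ℕ} (hm : 1 ≤ m)
    (hB : supMu A Q < absDet A ^ (2 / (d : ℝ) - 1 / (2 * (m : ℝ)))) (R : ℝ) :
    ∃ M : (Fin d → ℤ) → ℝ, Summable M ∧ ∀ ξ, ‖ξ‖ ≤ R → ∀ k,
      (phiHat A Q (ξ + latticePoint k) ^ m) ^ 2 ≤ M k := by
  obtain ⟨C, τ, hC, hτ, hle⟩ := exists_phiHat_decay hd hQ h hm hB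
  have hτ0 : 0 < τ := lt_of_le_of_lt (Nat.cast_nonneg d) hτ
  refine ⟨fun k => C * (1 + R) ^ τ * (1 + ‖(fun i => (k i : ℝ) : Fin d → ℝ)‖) ^ (-τ),
    (summable_one_add_norm_rpow hτ).mul_left _, fun ξ hξ k => (hle _).trans ?_⟩
  have hR : 0 ≤ R := (norm_nonneg _).trans hξ
  simp only [mul_assoc]
  gcongr
  have h1 : 1 + ‖(fun i => (k i : ℝ) : Fin d → ℝ)‖ ≤ (1 + R) * (1 + ‖ξ + latticePoint k‖) :=
    (one_add_norm_le_mul ξ k).trans (by gcongr)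
  calc (1 + ‖ξ + latticePoint k‖) ^ (-τ)
      = (1 + R) ^ τ * ((1 + R) * (1 + ‖ξ + latticePoint k‖)) ^ (-τ) := by
        rw [Real.mul_rpow (by positivity) (by positivity), ← mul_assoc,
          ← Real.rpow_add (by positivity), add_neg_cancel, Real.rpow_zero, one_mul]
    _ ≤ _ := by
        gcongr ?_ * ?_
        exact Real.rpow_le_rpow_of_nonpos (by positivity) h1 (by linarith)

/-- Compactness: 0 is the only point of 2πℤ^d in the cube, and φ̂(0) = 1. -/
lemma exists_le_phiHat (hd : 1 ≤ d) (hQ : IsSimilarityMatrix A Q) (h : 1 < absDet A) :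
    ∃ a : ℝ, 0 < a ∧ ∀ ξ, ‖ξ‖ ≤ Real.pi → a ≤ phiHat A Q ξ := by
  obtain ⟨ξ₀, h0, hmin⟩ := (isCompact_closedBall (0 : Fin d → ℝ) Real.pi).exists_isMinOn
    ⟨0, by simpa using Real.pi_pos.le⟩ (continuous_phiHat hd hQ h).continuousOn
  refine ⟨phiHat A Q ξ₀, ?_, fun ξ hξ => hmin (by simpa using hξ)⟩
  by_cases hz : ξ₀ = 0
  · rw [hz, phiHat_zero hQ h]; exact one_pos
  · refine phiHat_pos hd hQ h fun k hk => hz ?_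
    rw [mem_closedBall_zero_iff] at h0
    rw [hk]
    ext i
    have h1 := (norm_le_pi_norm ξ₀ i).trans h0
    rw [hk] at h1
    simp only [latticePoint, Pi.smul_apply, smul_eq_mul, Real.norm_eq_abs, abs_mul,
      abs_of_pos Real.two_pi_pos] at h1
    have h2 : |(k i : ℝ)| < 1 := by
      nlinarith [Real.pi_pos]
    have h3 : k i = 0 := by
      have : |k i| < 1 := by exact_mod_cast h2
      exact Int.abs_lt_one_iff.1 this
    simp [latticePoint, h3]

/-! ### Trigonometric polynomials on the unit cube -/

/-- The character `ν ↦ e^{-2π i k·ν}`. -/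
noncomputable def character (k : Fin d → ℤ) (ν : EuclideanSpace ℝ (Fin d)) : ℂ :=
  Complex.exp (((-(2 * Real.pi * ∑ i, k i * ν i) : ℝ) : ℂ) * Complex.I)

lemma norm_character (k : Fin d → ℤ) (ν : EuclideanSpace ℝ (Fin d)) : ‖character k ν‖ = 1 :=
  Complex.norm_exp_ofReal_mul_I _

@[fun_prop]
lemma continuous_character (k : Fin d → ℤ) : Continuous (character k) := by
  unfold character
  fun_prop

lemma character_mul_conj (k l : Fin d → ℤ) (ν : EuclideanSpace ℝ (Fin d)) :
    character k ν * starRingEnd ℂ (character l ν) = character (k - l) ν := by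
  rw [character, character, character, ← Complex.exp_conj, ← Complex.exp_add]
  congr 1
  simp only [map_mul, Complex.conj_ofReal, Complex.conj_I, Pi.sub_apply, Int.cast_sub, sub_mul,
    Finset.sum_sub_distrib]
  push_cast
  ring

lemma character_zero (ν : EuclideanSpace ℝ (Fin d)) : character 0 ν = 1 := by
  simp [character]

lemma character_add_intCast (k l : Fin d → ℤ) (ν : EuclideanSpace ℝ (Fin d)) :
    character k (ν + WithLp.toLp 2 (fun i => (l i : ℝ))) = character k ν := by
  rw [character, character, Complex.exp_eq_exp_iff_exists_int]
  refine ⟨-∑ i, k i * l i, ?_⟩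
  simp only [PiLp.add_apply, mul_add, Finset.sum_add_distrib]
  push_cast
  ring

lemma character_eq_prod (k : Fin d → ℤ) (x : Fin d → ℝ) :
    character k (WithLp.toLp 2 x) =
      ∏ i, Complex.exp ((-(2 * Real.pi * k i) * Complex.I) * x i) := by
  rw [character, ← Complex.exp_sum]
  congr 1
  push_cast
  rw [Finset.mul_sum, ← Finset.sum_neg_distrib, Finset.sum_mul]
  exact Finset.sum_congr rfl fun i _ => by ring

/-- The closed unit cube with centre `k`. -/
def unitCube (k : Fin d → ℤ) : Set (EuclideanSpace ℝ (Fin d)) :=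
  {ν | ∀ i, |ν i - k i| ≤ 1 / 2}

lemma isClosed_unitCube (k : Fin d → ℤ) : IsClosed (unitCube k) := by
  simp only [unitCube, Set.ofPred_forall]
  exact isClosed_iInter fun i => isClosed_le (by fun_prop) (by fun_prop)

lemma iUnion_unitCube : ⋃ k : Fin d → ℤ, unitCube k = Set.univ :=
  Set.eq_univ_of_forall fun ν => Set.mem_iUnion.2 ⟨fun i => round (ν i), fun _ => abs_sub_round _⟩

lemma unitCube_zero_eq : (unitCube 0 : Set (EuclideanSpace ℝ (Fin d))) =
    WithLp.ofLp ⁻¹' (Set.univ.pi fun _ => Set.Icc (-(1 / 2) : ℝ) (1 / 2)) := by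
  ext ν
  simp [unitCube, abs_le, Pi.le_def, forall_and]

lemma integral_exp_Icc (n : ℤ) :
    ∫ x in Set.Icc (-(1 / 2) : ℝ) (1 / 2),
      Complex.exp ((-(2 * Real.pi * n) * Complex.I) * x) = if n = 0 then 1 else 0 := by
  rw [integral_Icc_eq_integral_Ioc, ← intervalIntegral.integral_of_le (by norm_num)]
  split_ifs with hn
  · simp [hn]; norm_num
  · have hc : (-(2 * Real.pi * n) * Complex.I : ℂ) ≠ 0 := by
      simp [Real.pi_ne_zero, hn]
    rw [integral_exp_mul_complex hc, div_eq_zero_iff, or_iff_left hc, sub_eq_zero,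
      Complex.exp_eq_exp_iff_exists_int]
    refine ⟨-n, ?_⟩
    push_cast
    ring

lemma integral_character_unitCube (k : Fin d → ℤ) :
    ∫ ν in unitCube 0, character k ν = if k = 0 then 1 else 0 := by
  have h1 := (PiLp.volume_preserving_toLp (Fin d)).setIntegral_preimage_emb
    (MeasurableEquiv.toLp 2 (Fin d → ℝ)).measurableEmbedding (character k) (unitCube 0)
  rw [← h1, unitCube_zero_eq, ← Set.preimage_comp]
  have h2 : (WithLp.ofLp ∘ WithLp.toLp 2 : (Fin d → ℝ) → (Fin d → ℝ)) = id := rfl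
  rw [h2, Set.preimage_id, volume_pi, Measure.restrict_pi_pi]
  simp only [character_eq_prod]
  rw [integral_fintype_prod_eq_prod
    (f := fun i (x : ℝ) => Complex.exp ((-(2 * Real.pi * k i) * Complex.I) * x))]
  simp only [integral_exp_Icc]
  rw [Finset.prod_ite_zero]
  simp [funext_iff]

lemma isCompact_unitCube_zero : IsCompact (unitCube 0 : Set (EuclideanSpace ℝ (Fin d))) := by
  rw [unitCube_zero_eq]
  exact (PiLp.homeomorph 2 _).isCompact_preimage.2 (isCompact_univ_pi fun _ => isCompact_Icc)

/-- The trigonometric polynomial with coefficients `c`. -/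
noncomputable def trigPoly (c : (Fin d → ℤ) →₀ ℂ) (ν : EuclideanSpace ℝ (Fin d)) : ℂ :=
  ∑ k ∈ c.support, c k * character k ν

@[fun_prop]
lemma continuous_trigPoly (c : (Fin d → ℤ) →₀ ℂ) : Continuous (trigPoly c) := by
  unfold trigPoly
  fun_prop

lemma trigPoly_add_intCast (c : (Fin d → ℤ) →₀ ℂ) (l : Fin d → ℤ)
    (ν : EuclideanSpace ℝ (Fin d)) :
    trigPoly c (ν + WithLp.toLp 2 (fun i => (l i : ℝ))) = trigPoly c ν := by
  simp only [trigPoly, character_add_intCast]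

/-- Parseval: characters are orthonormal on the unit cube. -/
lemma integral_norm_sq_trigPoly (c : (Fin d → ℤ) →₀ ℂ) :
    ∫ ν in unitCube 0, ‖trigPoly c ν‖ ^ 2 = ∑ k ∈ c.support, ‖c k‖ ^ 2 := by
  have hint : ∀ k, IntegrableOn (character k) (unitCube (0 : Fin d → ℤ)) := fun k =>
    (continuous_character k).continuousOn.integrableOn_compact isCompact_unitCube_zero
  have h1 : ∀ ν, ((‖trigPoly c ν‖ ^ 2 : ℝ) : ℂ) = ∑ k ∈ c.support, ∑ l ∈ c.support,
      c k * starRingEnd ℂ (c l) * character (k - l) ν := by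
    intro ν
    rw [Complex.ofReal_pow, ← Complex.mul_conj', trigPoly, map_sum, Finset.sum_mul_sum]
    refine Finset.sum_congr rfl fun k _ => Finset.sum_congr rfl fun l _ => ?_
    rw [map_mul, ← character_mul_conj]
    ring
  apply Complex.ofReal_injective
  rw [← integral_complex_ofReal]
  simp only [h1]
  rw [integral_finsetSum _ fun k _ => integrable_finsetSum _ fun l _ => (hint _).const_mul _]
  push_cast
  refine Finset.sum_congr rfl fun k hk => ?_
  rw [integral_finsetSum _ fun l _ => (hint _).const_mul _]
  simp only [integral_const_mul, integral_character_unitCube, sub_eq_zero]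
  simp only [mul_ite, mul_one, mul_zero, Finset.sum_ite_eq, hk, if_true]
  rw [Complex.mul_conj']

lemma lintegral_enorm_sq_trigPoly (c : (Fin d → ℤ) →₀ ℂ) :
    ∫⁻ ν in unitCube 0, ‖trigPoly c ν‖ₑ ^ 2 = ENNReal.ofReal (∑ k ∈ c.support, ‖c k‖ ^ 2) := by
  rw [← integral_norm_sq_trigPoly, ofReal_integral_eq_lintegral_ofReal]
  · refine lintegral_congr fun ν => ?_
    rw [ENNReal.ofReal_pow (norm_nonneg _), ofReal_norm]
  · exact ContinuousOn.integrableOn_compact isCompact_unitCube_zero (by fun_prop)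
  · exact Filter.Eventually.of_forall fun ν => by positivity

lemma lintegral_unitCube (k : Fin d → ℤ) (F : EuclideanSpace ℝ (Fin d) → ENNReal) :
    ∫⁻ ν in unitCube k, F ν =
      ∫⁻ ν in unitCube 0, F (ν + WithLp.toLp 2 (fun i => (k i : ℝ))) := by
  have h := (measurePreserving_add_right volume
    (WithLp.toLp 2 (fun i => (k i : ℝ)) : EuclideanSpace ℝ (Fin d))).setLIntegral_comp_preimage_emb
    (measurableEmbedding_addRight _) F (unitCube k)
  rw [← h]
  congr 2
  ext ν
  simp [unitCube]

/-! ### Riesz bounds for weighted trigonometric polynomials -/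

/-- The integral is split over the integer translates of the cube, on all of which the trigonometric
polynomial repeats. Only a covering is needed, so the overlapping faces are harmless. -/
lemma lintegral_trigPoly_mul_le {g : EuclideanSpace ℝ (Fin d) → ℂ} {M : (Fin d → ℤ) → ℝ}
    (hM : Summable M)
    (hg : ∀ ν ∈ unitCube 0, ∀ k : Fin d → ℤ,
      ‖g (ν + WithLp.toLp 2 (fun i => (k i : ℝ)))‖ ^ 2 ≤ M k)
    (c : (Fin d → ℤ) →₀ ℂ) :
    ∫⁻ ν, ‖trigPoly c ν * g ν‖ₑ ^ 2 ≤
      ENNReal.ofReal ((∑' k, M k) * ∑ k ∈ c.support, ‖c k‖ ^ 2) := by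
  have h0 : (0 : EuclideanSpace ℝ (Fin d)) ∈ unitCube 0 := by simp [unitCube]
  have hM0 : ∀ k, 0 ≤ M k := fun k => (sq_nonneg _).trans (hg 0 h0 k)
  calc ∫⁻ ν, ‖trigPoly c ν * g ν‖ₑ ^ 2
      = ∫⁻ ν in ⋃ k : Fin d → ℤ, unitCube k, ‖trigPoly c ν * g ν‖ₑ ^ 2 := by
        rw [iUnion_unitCube, Measure.restrict_univ]
    _ ≤ ∑' k : Fin d → ℤ, ∫⁻ ν in unitCube k, ‖trigPoly c ν * g ν‖ₑ ^ 2 :=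
        lintegral_iUnion_le _ _
    _ ≤ ∑' k : Fin d → ℤ,
        ENNReal.ofReal (M k) * ENNReal.ofReal (∑ k ∈ c.support, ‖c k‖ ^ 2) := by
        refine ENNReal.tsum_le_tsum fun k => ?_
        rw [lintegral_unitCube, ← lintegral_enorm_sq_trigPoly,
          ← lintegral_const_mul' _ _ ENNReal.ofReal_ne_top]
        refine setLIntegral_mono' (isClosed_unitCube 0).measurableSet fun ν hν => ?_
        rw [trigPoly_add_intCast, enorm_mul, mul_pow, mul_comm]
        gcongr
        rw [← ofReal_norm, ← ENNReal.ofReal_pow (norm_nonneg _)]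
        exact ENNReal.ofReal_le_ofReal (hg ν hν k)
    _ = _ := by
        rw [ENNReal.tsum_mul_right, ← ENNReal.ofReal_tsum_of_nonneg hM0 hM,
          ENNReal.ofReal_mul (tsum_nonneg hM0)]

/-- The central cube alone already suffices. -/
lemma le_lintegral_trigPoly_mul {g : EuclideanSpace ℝ (Fin d) → ℂ} {a : ℝ} (ha : 0 ≤ a)
    (hg : ∀ ν ∈ unitCube (0 : Fin d → ℤ), a ≤ ‖g ν‖ ^ 2) (c : (Fin d → ℤ) →₀ ℂ) :
    ENNReal.ofReal (a * ∑ k ∈ c.support, ‖c k‖ ^ 2) ≤ ∫⁻ ν, ‖trigPoly c ν * g ν‖ₑ ^ 2 := by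
  rw [ENNReal.ofReal_mul ha, ← lintegral_enorm_sq_trigPoly,
    ← lintegral_const_mul' _ _ ENNReal.ofReal_ne_top]
  refine le_trans ?_ (setLIntegral_le_lintegral (unitCube 0) _)
  refine setLIntegral_mono' (isClosed_unitCube 0).measurableSet fun ν hν => ?_
  rw [enorm_mul, mul_pow, mul_comm]
  gcongr
  rw [← ofReal_norm (g ν), ← ENNReal.ofReal_pow (norm_nonneg _)]
  exact ENNReal.ofReal_le_ofReal (hg ν hν)

/-! ### The Fourier transform of integer shifts -/

lemma fourierInv_compSubConst_neg (F : 𝓢(EuclideanSpace ℝ (Fin d), ℂ)) (k : Fin d → ℤ)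
    (ν : EuclideanSpace ℝ (Fin d)) :
    𝓕⁻ (F.compSubConstCLM ℂ (-WithLp.toLp 2 (fun i => (k i : ℝ)))) ν =
      character k ν * 𝓕⁻ F ν := by
  set κ : EuclideanSpace ℝ (Fin d) := WithLp.toLp 2 (fun i => (k i : ℝ)) with hκ
  rw [SchwartzMap.fourierInv_coe, SchwartzMap.fourierInv_coe, Real.fourierInv_eq',
    Real.fourierInv_eq', ← integral_const_mul,
    ← integral_add_right_eq_self (fun v => character k ν *
      Complex.exp ((2 * Real.pi * inner ℝ v ν : ℝ) * Complex.I) • F v) κ]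
  refine integral_congr_ae (Filter.Eventually.of_forall fun v => ?_)
  have h1 : inner ℝ κ ν = ∑ i, k i * ν i := by
    simp [hκ, PiLp.inner_apply, mul_comm]
  have h2 : Complex.exp ((2 * Real.pi * inner ℝ v ν : ℝ) * Complex.I) = character k ν *
      Complex.exp ((2 * Real.pi * inner ℝ (v + κ) ν : ℝ) * Complex.I) := by
    rw [character, ← Complex.exp_add, inner_add_left, h1]
    congr 1
    push_cast
    ring
  simp only [SchwartzMap.compSubConstCLM_apply, sub_neg_eq_add, smul_eq_mul]
  rw [h2, mul_assoc]

lemma toTemperedDistribution_injective :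
    Function.Injective (fun f : Lp ℂ 2 (volume : Measure (EuclideanSpace ℝ (Fin d))) =>
      (f : 𝓢'(EuclideanSpace ℝ (Fin d), ℂ))) :=
  LinearMap.ker_eq_bot.1 (Lp.ker_toTemperedDistributionCLM_eq_bot (F := ℂ) (p := 2)
    (μ := (volume : Measure (EuclideanSpace ℝ (Fin d)))))

lemma memLp_character_mul (k : Fin d → ℤ) {g : EuclideanSpace ℝ (Fin d) → ℂ}
    (hg : MemLp g 2) : MemLp (fun ν => character k ν * g ν) 2 :=
  hg.congr_norm ((continuous_character k).aestronglyMeasurable.mul hg.1)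
    (Filter.Eventually.of_forall fun ν => by rw [norm_mul, norm_character, one_mul])

/-- The L² transform is not given by a pointwise integral, so the identity is tested against
Schwartz functions: the shift moves onto 𝓕 f, where `fourierInv_compSubConst_neg` turns it into a
character. -/
lemma fourier_integerShift (k : Fin d → ℤ)
    (φ : Lp ℂ 2 (volume : Measure (EuclideanSpace ℝ (Fin d)))) :
    𝓕 (integerShift k φ) = (memLp_character_mul k (Lp.memLp (𝓕 φ))).toLp _ := by
  apply toTemperedDistribution_injective
  ext f
  simp only
  rw [← Lp.fourier_toTemperedDistribution_eq, TemperedDistribution.fourier_apply,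
    Lp.toTemperedDistribution_apply, Lp.toTemperedDistribution_apply]
  set κ : EuclideanSpace ℝ (Fin d) := WithLp.toLp 2 (fun i => (k i : ℝ)) with hκ
  set F := (𝓕 f).compSubConstCLM ℂ (-κ) with hF
  have h1 : ∀ ν, 𝓕⁻ F ν = character k ν * f ν := fun ν => by
    rw [hF, fourierInv_compSubConst_neg, FourierTransform.fourierInv_fourier_eq]
  calc ∫ x, 𝓕 f x • (integerShift k φ) x = ∫ x, 𝓕 f x • φ (x - κ) := by
        refine integral_congr_ae ?_
        filter_upwards [Lp.coeFn_compMeasurePreserving φ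
          (measurePreserving_sub_right (volume : Measure (EuclideanSpace ℝ (Fin d))) κ)] with x hx
        rw [integerShift, hx]
        rfl
    _ = ∫ x, F x • φ x := by
        rw [← integral_sub_right_eq_self (fun x => F x • φ x) κ]
        simp [hF]
    _ = (φ : 𝓢'(EuclideanSpace ℝ (Fin d), ℂ)) (𝓕 (𝓕⁻ F)) := by
        rw [FourierTransform.fourier_fourierInv_eq, Lp.toTemperedDistribution_apply]
    _ = ((𝓕 φ : Lp ℂ 2 (volume : Measure (EuclideanSpace ℝ (Fin d)))) :
          𝓢'(EuclideanSpace ℝ (Fin d), ℂ)) (𝓕⁻ F) := by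
        rw [← Lp.fourier_toTemperedDistribution_eq, TemperedDistribution.fourier_apply]
    _ = _ := by
        rw [Lp.toTemperedDistribution_apply]
        refine integral_congr_ae ?_
        filter_upwards [(memLp_character_mul k (Lp.memLp (𝓕 φ))).coeFn_toLp] with ν hν
        rw [hν, h1]
        simp only [smul_eq_mul]
        ring

lemma ofReal_norm_sq_Lp_two (f : Lp ℂ 2 (volume : Measure (EuclideanSpace ℝ (Fin d)))) :
    ENNReal.ofReal (‖f‖ ^ 2) = ∫⁻ ν, ‖f ν‖ₑ ^ 2 := by
  have h := eLpNorm_nnreal_pow_eq_lintegral (f := f)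
    (μ := (volume : Measure (EuclideanSpace ℝ (Fin d)))) (p := 2) two_ne_zero
  rw [ENNReal.ofReal_pow (norm_nonneg _), ofReal_norm, Lp.enorm_def]
  simpa using h

lemma coeFn_fourier_sum_integerShift (c : (Fin d → ℤ) →₀ ℂ)
    (φ : Lp ℂ 2 (volume : Measure (EuclideanSpace ℝ (Fin d)))) :
    (𝓕 (∑ k ∈ c.support, c k • integerShift k φ) :
      Lp ℂ 2 (volume : Measure (EuclideanSpace ℝ (Fin d)))) =ᵐ[volume]
      fun ν => trigPoly c ν * (𝓕 φ : Lp ℂ 2 (volume : Measure (EuclideanSpace ℝ (Fin d)))) ν := by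
  have h1 : 𝓕 (∑ k ∈ c.support, c k • integerShift k φ) =
      ∑ k ∈ c.support, c k • 𝓕 (integerShift k φ) := by
    change Lp.fourierTransformₗᵢ _ _ _ = _
    rw [map_sum]
    simp only [map_smul]
    rfl
  rw [h1]
  have h2 : ∀ s : Finset (Fin d → ℤ), (∑ k ∈ s, c k • 𝓕 (integerShift k φ) :
      Lp ℂ 2 (volume : Measure (EuclideanSpace ℝ (Fin d)))) =ᵐ[volume] fun ν =>
        (∑ k ∈ s, c k * character k ν) *
          (𝓕 φ : Lp ℂ 2 (volume : Measure (EuclideanSpace ℝ (Fin d)))) ν := by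
    classical
    intro s
    induction s using Finset.induction_on with
    | empty =>
      simp only [Finset.sum_empty, zero_mul]
      exact Lp.coeFn_zero _ _ _
    | insert k s hk ih =>
      simp only [Finset.sum_insert hk]
      filter_upwards [Lp.coeFn_add (c k • 𝓕 (integerShift k φ))
        (∑ k ∈ s, c k • 𝓕 (integerShift k φ)), Lp.coeFn_smul (c k) (𝓕 (integerShift k φ)), ih,
        (memLp_character_mul k (Lp.memLp (𝓕 φ))).coeFn_toLp] with ν h1 h2 h3 h4
      rw [h1, Pi.add_apply, h2, Pi.smul_apply, h3, fourier_integerShift, h4, smul_eq_mul]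
      ring
  exact h2 _

/-! ### The elliptic scaling function -/

/-- The Fourier transform of the elliptic scaling function of order `m`, in the variable `ν`
with `ξ = 2π ν`. -/
noncomputable def scalingSymbol (A : Matrix (Fin d) (Fin d) ℤ) (Q : Matrix (Fin d) (Fin d) ℝ)
    (m : ℕ) (ν : EuclideanSpace ℝ (Fin d)) : ℂ :=
  ((phiHat A Q ((2 * Real.pi) • ν.ofLp) ^ m : ℝ) : ℂ)

lemma norm_sq_scalingSymbol (m : ℕ) (ν : EuclideanSpace ℝ (Fin d)) :
    ‖scalingSymbol A Q m ν‖ ^ 2 = (phiHat A Q ((2 * Real.pi) • ν.ofLp) ^ m) ^ 2 := by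
  rw [scalingSymbol, Complex.norm_real, Real.norm_eq_abs, sq_abs]

lemma norm_two_pi_smul_le {ν : EuclideanSpace ℝ (Fin d)} (hν : ν ∈ unitCube 0) :
    ‖(2 * Real.pi) • ν.ofLp‖ ≤ Real.pi := by
  have hpi := Real.pi_pos
  rw [pi_norm_le_iff_of_nonneg hpi.le]
  intro i
  have := hν i
  simp only [Pi.zero_apply, Int.cast_zero, sub_zero] at this
  rw [Pi.smul_apply, smul_eq_mul, Real.norm_eq_abs, abs_mul, abs_of_pos Real.two_pi_pos]
  nlinarith

lemma continuous_scalingSymbol (hd : 1 ≤ d) (hQ : IsSimilarityMatrix A Q) (h : 1 < absDet A)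
    (m : ℕ) : Continuous (scalingSymbol A Q m) := by
  have hc := continuous_phiHat hd hQ h
  unfold scalingSymbol
  fun_prop

lemma exists_scalingSymbol_bounds (hd : 1 ≤ d) (hQ : IsSimilarityMatrix A Q)
    (h : 1 < absDet A) {m : ℕ} (hm : 1 ≤ m)
    (hB : supMu A Q < absDet A ^ (2 / (d : ℝ) - 1 / (2 * (m : ℝ)))) :
    ∃ a b : ℝ, 0 < a ∧ ∀ c : (Fin d → ℤ) →₀ ℂ,
      ENNReal.ofReal (a * ∑ k ∈ c.support, ‖c k‖ ^ 2) ≤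
        ∫⁻ ν, ‖trigPoly c ν * scalingSymbol A Q m ν‖ₑ ^ 2 ∧
      ∫⁻ ν, ‖trigPoly c ν * scalingSymbol A Q m ν‖ₑ ^ 2 ≤
        ENNReal.ofReal (b * ∑ k ∈ c.support, ‖c k‖ ^ 2) := by
  obtain ⟨M, hM, hle⟩ := exists_phiHat_add_latticePoint_le hd hQ h hm hB Real.pi
  obtain ⟨a, ha, hlow⟩ := exists_le_phiHat hd hQ h
  refine ⟨(a ^ m) ^ 2, ∑' k, M k, by positivity, fun c =>
    ⟨le_lintegral_trigPoly_mul (by positivity) (fun ν hν => ?_) c,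
      lintegral_trigPoly_mul_le hM (fun ν hν k => ?_) c⟩⟩
  · rw [norm_sq_scalingSymbol]
    gcongr
    exact hlow _ (norm_two_pi_smul_le hν)
  · rw [norm_sq_scalingSymbol, WithLp.ofLp_add, smul_add]
    exact hle _ (norm_two_pi_smul_le hν) k

lemma memLp_scalingSymbol (hd : 1 ≤ d) (hQ : IsSimilarityMatrix A Q)
    (h : 1 < absDet A) {m : ℕ} (hm : 1 ≤ m)
    (hB : supMu A Q < absDet A ^ (2 / (d : ℝ) - 1 / (2 * (m : ℝ)))) :
    MemLp (scalingSymbol A Q m) 2 := by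
  obtain ⟨a, b, -, hab⟩ := exists_scalingSymbol_bounds hd hQ h hm hB
  -- For the single coefficient at 0 the trigonometric polynomial is 1, so the upper Riesz bound is
  -- the L² bound.
  have h1 := (hab (Finsupp.single 0 1)).2
  have h2 : ∀ ν : EuclideanSpace ℝ (Fin d), trigPoly (Finsupp.single 0 1) ν = 1 := fun ν => by
    rw [trigPoly, Finsupp.support_single _ one_ne_zero]
    simp [character_zero]
  simp only [h2, one_mul] at h1
  refine ⟨(continuous_scalingSymbol hd hQ h m).aestronglyMeasurable, ?_⟩
  rw [eLpNorm_lt_top_iff_lintegral_rpow_enorm_lt_top two_ne_zero ENNReal.ofNat_ne_top]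
  simpa using h1.trans_lt ENNReal.ofReal_lt_top

/-- Settles existence, uniqueness and L² membership at once. The integrability clause holds because
f and the symbol are both in L². -/
lemma isEllipticScalingFunction_iff {m : ℕ} (hmem : MemLp (scalingSymbol A Q m) 2)
    (T : 𝓢'(EuclideanSpace ℝ (Fin d), ℂ)) :
    IsEllipticScalingFunction A Q m T ↔
      T = ((𝓕⁻ (hmem.toLp _) : Lp ℂ 2 (volume : Measure (EuclideanSpace ℝ (Fin d)))) :
        𝓢'(EuclideanSpace ℝ (Fin d), ℂ)) := by
  have h1 : ∀ f : 𝓢(EuclideanSpace ℝ (Fin d), ℂ),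
      ((hmem.toLp _ : Lp ℂ 2 (volume : Measure (EuclideanSpace ℝ (Fin d)))) :
        𝓢'(EuclideanSpace ℝ (Fin d), ℂ)) f = ∫ ν, f ν * scalingSymbol A Q m ν := by
    intro f
    rw [Lp.toTemperedDistribution_apply]
    refine integral_congr_ae ?_
    filter_upwards [hmem.coeFn_toLp] with ν hν
    rw [hν, smul_eq_mul]
  rw [← Lp.fourierInv_toTemperedDistribution_eq]
  constructor
  · intro hT
    rw [← FourierTransform.fourierInv_fourier_eq (F := 𝓢'(EuclideanSpace ℝ (Fin d), ℂ)) T]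
    congr 1
    ext f
    rw [(hT f).2, h1]
    rfl
  · rintro rfl f
    refine ⟨(f.memLp 2).integrable_mul hmem, ?_⟩
    rw [FourierTransform.fourier_fourierInv_eq, h1]
    rfl

lemma formsRieszBasis_integerShift (hd : 1 ≤ d) (hQ : IsSimilarityMatrix A Q)
    (h : 1 < absDet A) {m : ℕ} (hm : 1 ≤ m)
    (hB : supMu A Q < absDet A ^ (2 / (d : ℝ) - 1 / (2 * (m : ℝ))))
    (hmem : MemLp (scalingSymbol A Q m) 2) :
    FormsRieszBasis (fun k : Fin d → ℤ => integerShift k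
      (𝓕⁻ (hmem.toLp _) : Lp ℂ 2 (volume : Measure (EuclideanSpace ℝ (Fin d))))) := by
  obtain ⟨a, b, ha, hab⟩ := exists_scalingSymbol_bounds hd hQ h hm hB
  set φ := (𝓕⁻ (hmem.toLp _) : Lp ℂ 2 (volume : Measure (EuclideanSpace ℝ (Fin d)))) with hφ
  have hnorm : ∀ c : (Fin d → ℤ) →₀ ℂ,
      ENNReal.ofReal (‖∑ k ∈ c.support, c k • integerShift k φ‖ ^ 2) =
        ∫⁻ ν, ‖trigPoly c ν * scalingSymbol A Q m ν‖ₑ ^ 2 := by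
    intro c
    rw [← Lp.norm_fourier_eq, ofReal_norm_sq_Lp_two]
    refine lintegral_congr_ae ?_
    have hF : 𝓕 φ = hmem.toLp _ := FourierTransform.fourier_fourierInv_eq _
    filter_upwards [coeFn_fourier_sum_integerShift c φ, hmem.coeFn_toLp] with ν h1 h2
    rw [h1, hF, h2]
  -- `max` secures the required order of the two bounds.
  refine ⟨a, max a b, ha, le_max_left _ _, fun c => ⟨?_, ?_⟩⟩
  · rw [← ENNReal.ofReal_le_ofReal_iff (by positivity), hnorm]
    exact (hab c).1
  · rw [← ENNReal.ofReal_le_ofReal_iff (by positivity), hnorm]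
    refine (hab c).2.trans (ENNReal.ofReal_le_ofReal ?_)
    gcongr
    exact le_max_right _ _

end EllipticScaling

theorem mainTheorem10 (d : ℕ) (hd : 1 ≤ d) (A : Matrix (Fin d) (Fin d) ℤ)
    (hA : EllipticScaling.IsDilation A) (hiso : EllipticScaling.IsIsotropic A)
    (Q : Matrix (Fin d) (Fin d) ℝ) (hQ : EllipticScaling.IsSimilarityMatrix A Q)
    (m : ℕ) (hm : 1 ≤ m)
    (hB : EllipticScaling.supMu A Q <
      EllipticScaling.absDet A ^ (2 / (d : ℝ) - 1 / (2 * (m : ℝ)))) :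
    (∃! T : 𝓢'(EuclideanSpace ℝ (Fin d), ℂ), EllipticScaling.IsEllipticScalingFunction A Q m T) ∧
    (∀ T : 𝓢'(EuclideanSpace ℝ (Fin d), ℂ), EllipticScaling.IsEllipticScalingFunction A Q m T →
      ∃ φ : Lp ℂ 2 (volume : Measure (EuclideanSpace ℝ (Fin d))),
        (φ : 𝓢'(EuclideanSpace ℝ (Fin d), ℂ)) = T ∧
        EllipticScaling.FormsRieszBasis
          (fun k : Fin d → ℤ => EllipticScaling.integerShift k φ)) ∧
    (∀ ξ : Fin d → ℝ, Summable (fun k : Fin d → ℤ =>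
      |EllipticScaling.phiHat A Q (ξ + (2 * Real.pi) • (fun i => (k i : ℝ))) ^ m| ^ 2)) := by
  have h := EllipticScaling.one_lt_absDet hd hA
  have hmem := EllipticScaling.memLp_scalingSymbol hd hQ h hm hB
  refine ⟨⟨_, (EllipticScaling.isEllipticScalingFunction_iff hmem _).2 rfl, fun T hT =>
    (EllipticScaling.isEllipticScalingFunction_iff hmem T).1 hT⟩, fun T hT => ⟨_,
    ((EllipticScaling.isEllipticScalingFunction_iff hmem T).1 hT).symm,
    EllipticScaling.formsRieszBasis_integerShift hd hQ h hm hB hmem⟩, fun ξ => ?_⟩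
  -- The majorant is uniform on balls; radius ‖ξ‖ reaches an arbitrary ξ.
  obtain ⟨M, hM, hle⟩ :=
    EllipticScaling.exists_phiHat_add_latticePoint_le hd hQ h hm hB ‖ξ‖
  refine hM.of_nonneg_of_le (fun _ => by positivity) fun k => ?_
  rw [sq_abs]
  exact hle ξ le_rfl k
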